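/- **Setting.** Let $\mathfrak g$ be the Lie algebra of a compact Lie group, i.e. a finite-dimensional real Lie algebra with an inner product satisfying $\langle[\xi,\eta],\zeta\rangle+\langle\eta,[\xi,\zeta]\rangle=0$. Let $n\ge 2$, let $\Omega\subset\mathbb R^n$ be a bounded Lipschitz domain, and let $\mathcal T_h$ be a triangulation of $\overline\Omega$ (a finite simplicial complex with underlying space $\overline\Omega$; its elements $K$ are the closed $n$-simplices). For $\mathfrak g$-valued forms, $[u\wedge v]$ and $\langle u\wedge v\rangle$ denote the wedge products in which the coefficients are multiplied by the bracket and by the inner product, $d_Au=du+[A\wedge u]$ and $F_A=dA+\frac12[A\wedge A]$. Exterior derivatives are weak (distributional). Put $$V^0=\{\phi\in L^\infty\Lambda^0(\Omega,\mathfrak g):d\phi\in L^4\},\quad V^1=\{A\in L^4\Lambda^1(\Omega,\mathfrak g):dA\in L^2\},$$ $$\widehat V^{n-1}=\{\widehat D\in L^{4/3}\Lambda^{n-1}(\Omega,\mathfrak g):d\widehat D\in L^1\},\quad \widehat V^{n-2}=\{\widehat H\in L^2\Lambda^{n-2}(\Omega,\mathfrak g):d\widehat H\in L^{4/3}\},$$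 and let $DV^0$, $DV^1$ be defined like $V^0$, $V^1$, but with $d\phi$, $dA$ computed on the interior of each element $K$ separately; these spaces carry their graph norms. For a $k$-form $u$ and an $(n-k-1)$-form $v$ of this regularity on a set $U$ ($U=\Omega$ or $U=K$) put $$\int_{\partial U}\langle u\wedge v\rangle:=\int_U\bigl(\langle du\wedge v\rangle+(-1)^k\langle u\wedge dv\rangle\bigr).$$ Tangential traces are understood through this pairing. Thus $\mathring V^0$ (resp. $\mathring V^1$) consists of the $u\in V^0$ (resp. $V^1$) with $\int_{\partial\Omega}\langle u\wedge v\rangle=0$ for all $v\in\widehat V^{n-1}$ (resp. $\widehat V^{n-2}$). An $(n-2)$-form in $L^2(K)$ with exterior derivative in $L^{4/3}(K)$ has as tangential trace on $\partial K$ the functional $A'\mapsto\int_{\partial K}\langle A'\wedge\cdot\rangle$ on $DV^1$, and an $(n-1)$-form in $L^{4/3}(K)$ with exterior derivative in $L^1(K)$ has the functional $\phi'\mapsto\int_{\partial K}\langle\phi',\cdot\rangle$ on $DV^0$. Let $\epsilon_x:\bigwedge^1\to\bigwedge^{n-1}$ and $\mu_x^{-1}:\bigwedge^2\to\bigwedge^{n-2}$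 ($x\in\overline\Omega$) be symmetric isomorphisms ($\alpha\wedge\epsilon\beta=\beta\wedge\epsilon\alpha$, $\alpha\wedge\mu^{-1}\beta=\beta\wedge\mu^{-1}\alpha$), depending on $x$ in an $L^\infty$ way and extended to $\mathfrak g$-valued forms by acting trivially on coefficients. Let $I\subset\mathbb R$ be a nondegenerate interval, $A$ a $C^1$ curve $I\to DV^1$, $\phi$ a $C^0$ curve $I\to DV^0$, and $\rho$ a $C^1$ curve $I\to L^1\Lambda^n(\Omega,\mathfrak g)$. With space derivatives computed elementwise, put $E=-(\dot A+d_A\phi)$, $B=F_A$, $D=\epsilon E$, $H=\mu^{-1}B$, and assume that $D$ is a $C^1$ curve in $L^4\Lambda^{n-1}(\Omega,\mathfrak g)$. $(A,\phi)$ *solves the weak Yang–Mills equations* if $A$ is a $C^1$ curve in $\mathring V^1$, $\phi$ is a $C^0$ curve in $\mathring V^0$, and for all $t\in I$ $$\int_{\Omega}\bigl(\langle A'\wedge(\dot D-[\phi,D])\rangle-\langle d_AA'\wedge H\rangle\bigr)=0\quad\forall A'\in\mathring V^1,\qquad \int_{\Omega}\bigl(\langle d_A\phi'\wedge D\rangle+\langle\phi',\rho\rangle\bigr)=0\quad\forall\phi'\in\mathring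 V^0 .$$ For $\widehat H(t)\in\widehat V^{n-2}$ and $\widehat D(t)\in\widehat V^{n-1}$ ($t\in I$), $(A,\phi,\widehat H,\widehat D)$ *solves the domain-decomposed equations* if for all $t\in I$ and all $K\in\mathcal T_h$ $$\int_K\bigl(\langle A'\wedge(\dot D-[\phi,D])\rangle-\langle d_AA'\wedge H\rangle\bigr)+\int_{\partial K}\langle A'\wedge\widehat H\rangle=0\quad\forall A'\in DV^1,$$ $$\int_K\bigl(\langle d_A\phi'\wedge D\rangle+\langle\phi',\rho\rangle\bigr)-\int_{\partial K}\langle\phi',\widehat D\rangle=0\quad\forall\phi'\in DV^0,$$ $$\sum_{K}\int_{\partial K}\langle A\wedge\widehat H'\rangle=0\quad\forall\widehat H'\in\widehat V^{n-2},\qquad \sum_{K}\int_{\partial K}\langle\phi,\widehat D'\rangle=0\quad\forall\widehat D'\in\widehat V^{n-1}.$$ **Proposition.** (i) For all $\widehat H:I\to\widehat V^{n-2}$ and $\widehat D:I\to\widehat V^{n-1}$, the tuple $(A,\phi,\widehat H,\widehat D)$ solves the domain-decomposed equations if and only if $(A,\phi)$ solves the weak Yang–Mills equations and, at every $t\in I$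 and on every element $K$, the tangential traces of $H$ and $D$ on $\partial K$ exist and $\widehat H|_{\partial K}=H|_{\partial K}$, $\widehat D|_{\partial K}=D|_{\partial K}$. (ii) If $(A,\phi)$ solves the weak Yang–Mills equations, then there are $\widehat H$, $\widehat D$ such that $(A,\phi,\widehat H,\widehat D)$ solves the domain-decomposed equations. -/

import Mathlib

open MeasureTheory Set
open scoped ENNReal NNReal ContDiff Topology TensorProduct

noncomputable section

namespace YM

/-! ### The Lie algebra -/

/-- A normed group and a Lie ring with the same addition. -/
class NormedLieRing (g : Type*) extends NormedAddCommGroup g, LieRing g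

/-- A real Lie algebra with an invariant inner product.  With `[FiniteDimensional ℝ g]` these are
exactly the Lie algebras of compact Lie groups, with the choice of an invariant inner product. -/
class InvariantLieAlgebra (g : Type*) [NormedLieRing g] extends
    InnerProductSpace ℝ g, LieAlgebra ℝ g where
  invariant : ∀ ξ η ζ : g, Inner.inner ℝ ⁅ξ, η⁆ ζ + Inner.inner ℝ η ⁅ξ, ζ⁆ = 0

/-- The Lie bracket as a continuous bilinear map. -/
def bracketL (g : Type*) [NormedLieRing g] [InvariantLieAlgebra g] [FiniteDimensional ℝ g] :
    g →L[ℝ] g →L[ℝ] g :=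
  LinearMap.toContinuousLinearMap
    ((LinearMap.toContinuousLinearMap : (g →ₗ[ℝ] g) ≃ₗ[ℝ] (g →L[ℝ] g)).toLinearMap ∘ₗ
      (LieModule.toEnd ℝ g g : g →ₗ[ℝ] (g →ₗ[ℝ] g)))

/-! ### Exterior algebra -/

/-- `ℝⁿ` with its Euclidean structure. -/
abbrev Space (n : ℕ) : Type := EuclideanSpace ℝ (Fin n)

/-- `F`-valued alternating `k`-forms on `ℝⁿ`, that is `⋀ᵏ(ℝⁿ)* ⊗ F`. -/
abbrev Form (n k : ℕ) (F : Type*) [NormedAddCommGroup F] [NormedSpace ℝ F] : Type _ :=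
  Space n [⋀^Fin k]→L[ℝ] F

section Wedge

variable {F₁ F₂ F₃ : Type*} [NormedAddCommGroup F₁] [NormedSpace ℝ F₁]
  [NormedAddCommGroup F₂] [NormedSpace ℝ F₂] [NormedAddCommGroup F₃] [NormedSpace ℝ F₃]

/-- The exterior product of vector-valued forms, where the coefficients are multiplied by a bilinear
map `β`: `(a ⊗ ξ) ∧ (b ⊗ η) = (a ∧ b) ⊗ β ξ η`, a sum over `(k, l)`-shuffles.  The degree `j` of the
product is only required to be propositionally equal to `k + l`. -/
def wedge {n k l j : ℕ} (β : F₁ →L[ℝ] F₂ →L[ℝ] F₃) (h : k + l = j)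
    (u : Form n k F₁) (v : Form n l F₂) : Form n j F₃ :=
  { ((TensorProduct.lift β.toLinearMap₁₂).compAlternatingMap
      (u.toAlternatingMap.domCoprod v.toAlternatingMap)).domDomCongr
        (finSumFinEquiv.trans (finCongr h)) with
    cont := by
      have key : ∀ σ : Equiv.Perm.ModSumCongr (Fin k) (Fin l), Continuous fun w : Fin j → Space n =>
          TensorProduct.lift β.toLinearMap₁₂
            (AlternatingMap.domCoprod.summand u.toAlternatingMap v.toAlternatingMap σ
              (fun i => w ((finSumFinEquiv.trans (finCongr h)) i))) := by
        intro σ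
        induction σ using Quotient.inductionOn' with | _ σ
        have h1 : Continuous fun w : Fin j → Space n =>
            u (fun i => w ((finSumFinEquiv.trans (finCongr h)) (σ (Sum.inl i)))) := by fun_prop
        have h2 : Continuous fun w : Fin j → Space n =>
            v (fun i => w ((finSumFinEquiv.trans (finCongr h)) (σ (Sum.inr i)))) := by fun_prop
        have h3 : Continuous fun w : Fin j → Space n => ((Equiv.Perm.sign σ : ℤˣ) : ℤ) •
            β (u (fun i => w ((finSumFinEquiv.trans (finCongr h)) (σ (Sum.inl i)))))
              (v (fun i => w ((finSumFinEquiv.trans (finCongr h)) (σ (Sum.inr i))))) :=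
          ((β.continuous.comp h1).clm_apply h2).fun_const_smul _
        convert! h3 using 2 with w
        exact map_zsmul (TensorProduct.lift β.toLinearMap₁₂) ((Equiv.Perm.sign σ : ℤˣ) : ℤ)
          ((u fun i => w ((finSumFinEquiv.trans (finCongr h)) (σ (Sum.inl i)))) ⊗ₜ[ℝ]
            (v fun i => w ((finSumFinEquiv.trans (finCongr h)) (σ (Sum.inr i)))))
      have hs := continuous_finsetSum (Finset.univ (α := Equiv.Perm.ModSumCongr (Fin k) (Fin l)))
        (fun σ _ => key σ)
      convert hs using 2 with w
      change TensorProduct.lift β.toLinearMap₁₂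
        (AlternatingMap.domCoprod u.toAlternatingMap v.toAlternatingMap _) = _
      rw [AlternatingMap.domCoprod_apply, sum_apply, map_sum]
      rfl }

/-- The coefficient of an `n`-form on `ℝⁿ` with respect to `dx₁ ∧ ⋯ ∧ dxₙ`; the integral of an
`n`-form is the Lebesgue integral of this coefficient. -/
def coeff {n : ℕ} (α : Form n n ℝ) : ℝ := α fun i => EuclideanSpace.single i 1

end Wedge

/-- `[u ∧ v]`. -/
def brk {g : Type*} [NormedLieRing g] [InvariantLieAlgebra g] [FiniteDimensional ℝ g]
    {n k l j : ℕ} (h : k + l = j) (u : Form n k g) (v : Form n l g) : Form n j g :=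
  wedge (bracketL g) h u v

/-- The coefficient of the `n`-form `⟨u ∧ v⟩` for forms of complementary degrees. -/
def pair {g : Type*} [NormedAddCommGroup g] [InnerProductSpace ℝ g]
    {n k l : ℕ} (h : k + l = n) (u : Form n k g) (v : Form n l g) : ℝ :=
  coeff (wedge (innerSL ℝ) h u v)

/-- The extension `T ⊗ id` to `g`-valued forms of a map between spaces of real-valued forms. -/
def extendCoeff {g : Type*} [NormedAddCommGroup g] [InnerProductSpace ℝ g] [FiniteDimensional ℝ g]
    {n k l : ℕ} (T : Form n k ℝ →L[ℝ] Form n l ℝ) (u : Form n k g) : Form n l g :=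
  ∑ i, (ContinuousLinearMap.toSpanSingleton ℝ
      (stdOrthonormalBasis ℝ g i)).compContinuousAlternatingMap
    (T ((innerSL ℝ (stdOrthonormalBasis ℝ g i)).compContinuousAlternatingMap u))

/-! ### Domains and triangulations -/

/-- Lipschitz domains: connected open sets that near every boundary point are the strict epigraph of
a Lipschitz function over a hyperplane. -/
structure IsLipschitzDomain {n : ℕ} (Ω : Set (Space n)) : Prop where
  isOpen : IsOpen Ω
  isConnected : IsConnected Ω
  boundary : ∀ x ∈ frontier Ω, ∃ ν : Space n, ‖ν‖ = 1 ∧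
    ∃ (γ : (ℝ ∙ ν)ᗮ → ℝ) (C : ℝ≥0), LipschitzWith C γ ∧
      ∀ᶠ y in 𝓝 x, (y ∈ Ω ↔ γ ((ℝ ∙ ν)ᗮ.orthogonalProjectionOnto y) < inner ℝ ν y)

/-- A finite simplicial complex triangulates `closure Ω`. -/
structure IsTriangulation {n : ℕ} (T : Geometry.SimplicialComplex ℝ (Space n))
    (Ω : Set (Space n)) : Prop where
  finite : T.faces.Finite
  space_eq : T.space = closure Ω

/-- The elements of a triangulation: its (closed) `n`-simplices. -/
def elements {n : ℕ} (T : Geometry.SimplicialComplex ℝ (Space n)) : Set (Set (Space n)) :=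
  {K | ∃ s ∈ T.faces, s.card = n + 1 ∧ K = convexHull ℝ (s : Set (Space n))}

/-! ### Weak exterior derivatives, boundary integrals and function spaces -/

instance fact_one_le_four : Fact ((1 : ℝ≥0∞) ≤ 4) := ⟨by norm_num⟩

section Spaces

variable {g : Type*} [NormedAddCommGroup g] [InnerProductSpace ℝ g] {n : ℕ}

/-- The boundary integral `∫_{∂K} ⟨u ∧ v⟩`, which for forms of low regularity with weak exterior
derivatives `du`, `dv` is defined as `∫_K (⟨du ∧ v⟩ + (-1)ᵏ ⟨u ∧ dv⟩)`. -/
def bdryInt {k l : ℕ} (h : k + 1 + l = n) (K : Set (Space n))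
    (u : Space n → Form n k g) (du : Space n → Form n (k + 1) g)
    (v : Space n → Form n l g) (dv : Space n → Form n (l + 1) g) : ℝ :=
  ∫ x in K, (pair h (du x) (v x) + (-1) ^ k * pair (by omega) (u x) (dv x))

/-- `w` is the weak (distributional) exterior derivative of `u` on the open set `U`. -/
def IsWeakD {k : ℕ} (U : Set (Space n)) (u : Space n → Form n k g)
    (w : Space n → Form n (k + 1) g) : Prop :=
  ∀ (l : ℕ) (h : k + 1 + l = n) (η : Space n → Form n l g),
    ContDiff ℝ ∞ η → HasCompactSupport η → tsupport η ⊆ U →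
      bdryInt h U u w η (extDeriv η) = 0

variable (g)

/-- `Lᵖ` forms on `Ω`. -/
abbrev LpForm (Ω : Set (Space n)) (k : ℕ) (p : ℝ≥0∞) : Type _ :=
  Lp (Form n k g) p (volume.restrict Ω)

/-- Pairs of an `Lᵖ` `k`-form and an `L^q` `(k+1)`-form.  A space of forms `u ∈ Lᵖ` with
`du ∈ L^q` is represented by its graph, the set of the pairs `(u, du)`, and so carries the graph
norm. -/
abbrev FormPair (Ω : Set (Space n)) (k : ℕ) (p q : ℝ≥0∞) : Type _ :=
  LpForm g Ω k p × LpForm g Ω (k + 1) q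

/-- `{u ∈ Lᵖ Λᵏ(Ω) : du ∈ L^q Λᵏ⁺¹(Ω)}`. -/
def Conf (Ω : Set (Space n)) (k : ℕ) (p q : ℝ≥0∞) : Set (FormPair g Ω k p q) :=
  {u | IsWeakD Ω u.1 u.2}

/-- `{u ∈ Lᵖ Λᵏ(Ω) : d(u|_K) ∈ L^q Λᵏ⁺¹(K) for all elements K}`. -/
def Broken (Ω : Set (Space n)) (T : Geometry.SimplicialComplex ℝ (Space n)) (k : ℕ)
    (p q : ℝ≥0∞) : Set (FormPair g Ω k p q) :=
  {u | ∀ K ∈ elements T, IsWeakD (interior K) u.1 u.2}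

/-- `V⁰`. -/
def V0 (Ω : Set (Space n)) : Set (FormPair g Ω 0 ⊤ 4) := Conf g Ω 0 ⊤ 4

/-- `V¹`. -/
def V1 (Ω : Set (Space n)) : Set (FormPair g Ω 1 4 2) := Conf g Ω 1 4 2

/-- `DV⁰`. -/
def DV0 (Ω : Set (Space n)) (T : Geometry.SimplicialComplex ℝ (Space n)) :
    Set (FormPair g Ω 0 ⊤ 4) := Broken g Ω T 0 ⊤ 4

/-- `DV¹`. -/
def DV1 (Ω : Set (Space n)) (T : Geometry.SimplicialComplex ℝ (Space n)) :
    Set (FormPair g Ω 1 4 2) := Broken g Ω T 1 4 2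

variable {m : ℕ}

/-- The multiplier space `V̂ⁿ⁻¹`, in dimension `n = m + 2`. -/
def VhatD (Ω : Set (Space (m + 2))) : Set (FormPair g Ω (m + 1) (4 / 3) 1) :=
  Conf g Ω (m + 1) (4 / 3) 1

/-- The multiplier space `V̂ⁿ⁻²`, in dimension `n = m + 2`. -/
def VhatH (Ω : Set (Space (m + 2))) : Set (FormPair g Ω m 2 (4 / 3)) :=
  Conf g Ω m 2 (4 / 3)

/-- Forms in `V⁰` with vanishing tangential trace on `∂Ω`.  The trace is the functional
`D' ↦ ∫_{∂Ω} ⟨φ, D'⟩` on `V̂ⁿ⁻¹`. -/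
def V0ring (Ω : Set (Space (m + 2))) : Set (FormPair g Ω 0 ⊤ 4) :=
  {φ ∈ V0 g Ω | ∀ D' ∈ VhatD g Ω, bdryInt (by omega) Ω φ.1 φ.2 D'.1 D'.2 = 0}

/-- Forms in `V¹` with vanishing tangential trace on `∂Ω`.  The trace is the functional
`H' ↦ ∫_{∂Ω} ⟨A ∧ H'⟩` on `V̂ⁿ⁻²`. -/
def V1ring (Ω : Set (Space (m + 2))) : Set (FormPair g Ω 1 4 2) :=
  {A ∈ V1 g Ω | ∀ H' ∈ VhatH g Ω, bdryInt (by omega) Ω A.1 A.2 H'.1 H'.2 = 0}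

variable {g}

/-- `τ` is the tangential trace `v|_{∂K}` of an `Lʳ` form `v` on `K` with `dv ∈ Lˢ(K)`, that is the
functional `u ↦ ∫_{∂K} ⟨u ∧ v⟩` on the test space `S`. -/
def HasTangentialTrace {k l : ℕ} {p q : ℝ≥0∞} {Ω : Set (Space n)} (h : k + 1 + l = n)
    (S : Set (FormPair g Ω k p q)) (K : Set (Space n)) (r s : ℝ≥0∞)
    (v : Space n → Form n l g) (τ : S → ℝ) : Prop :=
  MemLp v r (volume.restrict K) ∧
    ∃ dv : Space n → Form n (l + 1) g, MemLp dv s (volume.restrict K) ∧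
      IsWeakD (interior K) v dv ∧ ∀ u : S, τ u = bdryInt h K u.1.1 u.1.2 v dv

/-- `v|_{∂K} = v'|_{∂K}`: both forms have a tangential trace on `∂K`, and it is the same. -/
def SameTrace {k l : ℕ} {p q : ℝ≥0∞} {Ω : Set (Space n)} (h : k + 1 + l = n)
    (S : Set (FormPair g Ω k p q)) (K : Set (Space n)) (r s : ℝ≥0∞)
    (v v' : Space n → Form n l g) : Prop :=
  ∃ τ : S → ℝ, HasTangentialTrace h S K r s v τ ∧ HasTangentialTrace h S K r s v' τ

end Spaces

/-! ### Fields and equations -/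

/-- The conditions on the permittivity (`k = 1`) and on the inverse permeability (`k = 2`): pointwise
symmetric isomorphisms from `k`-forms to `(n-k)`-forms that depend on the point in an `L^∞` way. -/
structure IsMaterialTensor {n k l : ℕ} (h : k + l = n) (Ω : Set (Space n))
    (κ : Space n → Form n k ℝ →L[ℝ] Form n l ℝ) : Prop where
  bijective : ∀ x ∈ closure Ω, Function.Bijective (κ x)
  symmetric : ∀ x ∈ closure Ω, ∀ a b : Form n k ℝ,
    wedge (ContinuousLinearMap.mul ℝ ℝ) h a (κ x b) =
      wedge (ContinuousLinearMap.mul ℝ ℝ) h b (κ x a)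
  memLp : MemLp κ ⊤ (volume.restrict Ω)

section Equations

variable {g : Type*} [NormedLieRing g] [InvariantLieAlgebra g] [FiniteDimensional ℝ g]

/-- The exterior covariant derivative `d_A u = du + [A ∧ u]` at a point. -/
def covD {n k : ℕ} (A : Form n 1 g) (u : Form n k g) (du : Form n (k + 1) g) :
    Form n (k + 1) g :=
  du + brk (by omega) A u

/-- The curvature `F_A = dA + ½ [A ∧ A]` at a point. -/
def curvature {n : ℕ} (A : Form n 1 g) (dA : Form n 2 g) : Form n 2 g :=
  dA + (1 / 2 : ℝ) • brk (by omega) A A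

variable {m : ℕ} {Ω : Set (Space (m + 2))}

/-- `E = -(Ȧ + d_A φ)`, with derivatives in space taken elementwise. -/
def electricField (I : Set ℝ) (A : ℝ → FormPair g Ω 1 4 2) (φ : ℝ → FormPair g Ω 0 ⊤ 4)
    (t : ℝ) (x : Space (m + 2)) : Form (m + 2) 1 g :=
  -((derivWithin A I t).1 x + covD ((A t).1 x) ((φ t).1 x) ((φ t).2 x))

/-- `H = μ⁻¹ B = μ⁻¹ F_A`, with derivatives in space taken elementwise. -/
def magneticField (μinv : Space (m + 2) → Form (m + 2) 2 ℝ →L[ℝ] Form (m + 2) m ℝ)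
    (A : ℝ → FormPair g Ω 1 4 2) (t : ℝ) (x : Space (m + 2)) : Form (m + 2) m g :=
  extendCoeff (μinv x) (curvature ((A t).1 x) ((A t).2 x))

/-- `∫_U (⟨A' ∧ (Ḋ - [φ, D])⟩ - ⟨d_A A' ∧ H⟩)` at time `t`. -/
def formA (U : Set (Space (m + 2))) (I : Set ℝ)
    (μinv : Space (m + 2) → Form (m + 2) 2 ℝ →L[ℝ] Form (m + 2) m ℝ)
    (A : ℝ → FormPair g Ω 1 4 2) (φ : ℝ → FormPair g Ω 0 ⊤ 4) (D : ℝ → LpForm g Ω (m + 1) 4)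
    (t : ℝ) (A' : FormPair g Ω 1 4 2) : ℝ :=
  ∫ x in U, (pair (by omega) (A'.1 x)
        (derivWithin D I t x - brk (by omega) ((φ t).1 x) (D t x) : Form (m + 2) (m + 1) g) -
      pair (by omega) (covD ((A t).1 x) (A'.1 x) (A'.2 x)) (magneticField μinv A t x))

/-- `∫_U (⟨d_A φ' ∧ D⟩ + ⟨φ', ρ⟩)` at time `t`. -/
def formφ (U : Set (Space (m + 2))) (A : ℝ → FormPair g Ω 1 4 2)
    (D : ℝ → LpForm g Ω (m + 1) 4) (ρ : ℝ → LpForm g Ω (m + 2) 1)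
    (t : ℝ) (φ' : FormPair g Ω 0 ⊤ 4) : ℝ :=
  ∫ x in U, (pair (by omega) (covD ((A t).1 x) (φ'.1 x) (φ'.2 x)) (D t x) +
      pair (by omega) (φ'.1 x) (ρ t x))

/-- `(A, φ)` solves the weak Yang–Mills (Euler–Lagrange) equations on the time interval `I`, with
zero tangential traces on `∂Ω`. -/
structure SolvesYM (I : Set ℝ)
    (μinv : Space (m + 2) → Form (m + 2) 2 ℝ →L[ℝ] Form (m + 2) m ℝ)
    (A : ℝ → FormPair g Ω 1 4 2) (φ : ℝ → FormPair g Ω 0 ⊤ 4) (D : ℝ → LpForm g Ω (m + 1) 4)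
    (ρ : ℝ → LpForm g Ω (m + 2) 1) : Prop where
  contDiffOn_A : ContDiffOn ℝ 1 A I
  mem_A : ∀ t ∈ I, A t ∈ V1ring g Ω
  continuousOn_φ : ContinuousOn φ I
  mem_φ : ∀ t ∈ I, φ t ∈ V0ring g Ω
  eq_A : ∀ t ∈ I, ∀ A' ∈ V1ring g Ω, formA Ω I μinv A φ D t A' = 0
  eq_φ : ∀ t ∈ I, ∀ φ' ∈ V0ring g Ω, formφ Ω A D ρ t φ' = 0

/-- `(A, φ, Ĥ, D̂)` solves the domain-decomposed Euler–Lagrange equations on `I`. -/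
structure SolvesDD (T : Geometry.SimplicialComplex ℝ (Space (m + 2))) (I : Set ℝ)
    (μinv : Space (m + 2) → Form (m + 2) 2 ℝ →L[ℝ] Form (m + 2) m ℝ)
    (A : ℝ → FormPair g Ω 1 4 2) (φ : ℝ → FormPair g Ω 0 ⊤ 4) (D : ℝ → LpForm g Ω (m + 1) 4)
    (ρ : ℝ → LpForm g Ω (m + 2) 1)
    (Hhat : ℝ → FormPair g Ω m 2 (4 / 3)) (Dhat : ℝ → FormPair g Ω (m + 1) (4 / 3) 1) :
    Prop where
  contDiffOn_A : ContDiffOn ℝ 1 A I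
  mem_A : ∀ t ∈ I, A t ∈ DV1 g Ω T
  continuousOn_φ : ContinuousOn φ I
  mem_φ : ∀ t ∈ I, φ t ∈ DV0 g Ω T
  mem_Hhat : ∀ t ∈ I, Hhat t ∈ VhatH g Ω
  mem_Dhat : ∀ t ∈ I, Dhat t ∈ VhatD g Ω
  eq_A : ∀ t ∈ I, ∀ K ∈ elements T, ∀ A' ∈ DV1 g Ω T,
    formA K I μinv A φ D t A' + bdryInt (by omega) K A'.1 A'.2 (Hhat t).1 (Hhat t).2 = 0
  eq_φ : ∀ t ∈ I, ∀ K ∈ elements T, ∀ φ' ∈ DV0 g Ω T,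
    formφ K A D ρ t φ' - bdryInt (by omega) K φ'.1 φ'.2 (Dhat t).1 (Dhat t).2 = 0
  continuity_A : ∀ t ∈ I, ∀ H' ∈ VhatH g Ω,
    ∑ᶠ K ∈ elements T, bdryInt (by omega) K (A t).1 (A t).2 H'.1 H'.2 = 0
  continuity_φ : ∀ t ∈ I, ∀ D' ∈ VhatD g Ω,
    ∑ᶠ K ∈ elements T, bdryInt (by omega) K (φ t).1 (φ t).2 D'.1 D'.2 = 0

end Equations

end YM

end

/-! Invariance of the inner product turns both weak equations into statements about boundary
pairings. Moving the bracket with `A` onto `H` and `D` gives candidate derivatives `derivH` = Ḋ -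
[φ, D] - [A ∧ H] and `derivD` = ρ - [A ∧ D]. The first form is then minus the pairing of A' with (H,
`derivH`), and the second is the pairing of φ' with (D, `derivD`), over Ω and over each element
alike (`formA_eq_neg_bdryInt`, `formφ_eq_bdryInt`).

The equation on an element K thus says that a multiplier and the field have the same pairings on K
with all broken forms. Smooth forms with compact support inside K are among these, so the candidate
is the weak derivative of the field on K, and the trace exists and equals that of the multiplier.
Summing over K against a form of zero trace on ∂Ω gives the global weak equation
(`sameTrace_and_bdryInt_eq_zero`).

The elementwise pairings always add up to the pairing over Ω (`finsum_bdryInt`). The continuity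
equations therefore say that the pairing over Ω vanishes for every multiplier; since smooth
compactly supported forms are multipliers, this is conformity together with zero trace
(`mem_conf_zero_trace_iff`).

Conversely, a weak solution may be tested with smooth compactly supported forms, so H and D have the
weak derivatives `derivH` and `derivD` on all of Ω. Uniqueness of weak derivatives, which rests on
nondegeneracy of the pairing, converts equality of traces into equality of pairings
(`bdryInt_eq_of_sameTrace`). By Hölder's inequality on the bounded set Ω, H and D themselves lie in
the multiplier spaces, which gives existence. -/

noncomputable section

namespace YM

/-! ### Algebra of the exterior product -/

section WedgeAlgebra

open Equiv

variable {F₁ F₂ F₃ F₄ F₅ : Type*} [NormedAddCommGroup F₁] [NormedSpace ℝ F₁]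
  [NormedAddCommGroup F₂] [NormedSpace ℝ F₂] [NormedAddCommGroup F₃] [NormedSpace ℝ F₃]
  [NormedAddCommGroup F₄] [NormedSpace ℝ F₄] [NormedAddCommGroup F₅] [NormedSpace ℝ F₅]

/-- The inclusion of the first `k` indices. -/
def firstIdx {k l j : ℕ} (h : k + l = j) (i : Fin k) : Fin j := Fin.cast h (Fin.castAdd l i)

/-- The inclusion of the last `l` indices. -/
def lastIdx {k l j : ℕ} (h : k + l = j) (i : Fin l) : Fin j := Fin.cast h (Fin.natAdd k i)

theorem val_firstIdx {k l j : ℕ} (h : k + l = j) (i : Fin k) : (firstIdx h i : ℕ) = i := rfl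

theorem val_lastIdx {k l j : ℕ} (h : k + l = j) (i : Fin l) : (lastIdx h i : ℕ) = k + i := rfl

/-- The sign of a permutation as a real number. -/
def rsign {ι : Type*} [Fintype ι] [DecidableEq ι] (σ : Perm ι) : ℝ := ((Perm.sign σ : ℤˣ) : ℤ)

theorem rsign_mul {ι : Type*} [Fintype ι] [DecidableEq ι] (σ τ : Perm ι) :
    rsign (σ * τ) = rsign σ * rsign τ := by
  simp [rsign]

theorem rsign_mul_self {ι : Type*} [Fintype ι] [DecidableEq ι] (σ : Perm ι) :
    rsign σ * rsign σ = 1 := by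
  rw [rsign, ← Int.cast_mul, ← Units.val_mul, Int.units_mul_self]; simp

theorem abs_rsign {ι : Type*} [Fintype ι] [DecidableEq ι] (σ : Perm ι) : |rsign σ| = 1 := by
  have h := rsign_mul_self σ
  rcases mul_self_eq_one_iff.1 h with h | h <;> simp [h]

/-- The exterior product as a sum over all permutations. -/
theorem wedge_apply {n k l j : ℕ} (β : F₁ →L[ℝ] F₂ →L[ℝ] F₃) (h : k + l = j)
    (u : Form n k F₁) (v : Form n l F₂) (x : Fin j → Space n) :
    wedge β h u v x = ((k.factorial * l.factorial : ℕ) : ℝ)⁻¹ • ∑ σ : Perm (Fin j),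
      rsign σ • β (u fun i => x (σ (firstIdx h i))) (v fun i => x (σ (lastIdx h i))) := by
  have h0 : ((k.factorial * l.factorial : ℕ) : ℝ) ≠ 0 := by positivity
  rw [eq_inv_smul_iff₀ h0]
  set e := finSumFinEquiv.trans (finCongr h) with he
  have h1 : wedge β h u v x = TensorProduct.lift β.toLinearMap₁₂
      (u.toAlternatingMap.domCoprod v.toAlternatingMap (fun i => x (e i))) := rfl
  -- The sum over all permutations is k! l! times the sum over shuffles.
  have h2 := congrArg (fun f => TensorProduct.lift β.toLinearMap₁₂ (f (fun i => x (e i))))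
    (MultilinearMap.domCoprod_alternization_eq u.toAlternatingMap v.toAlternatingMap)
  simp only [Fintype.card_fin, AlternatingMap.smul_apply, map_nsmul] at h2
  rw [h1, Nat.cast_smul_eq_nsmul, ← h2, MultilinearMap.alternatization_apply, map_sum,
    ← (Equiv.permCongr e).sum_comp]
  refine Finset.sum_congr rfl fun σ _ => ?_
  have h3 : rsign (e.permCongr σ) = ((Perm.sign σ : ℤˣ) : ℤ) := by
    rw [rsign, Perm.sign_permCongr]
  rw [h3, Int.cast_smul_eq_zsmul, Units.smul_def, map_zsmul]
  congr 1
  have h4 : ∀ i, e.permCongr σ (firstIdx h i) = e (σ (Sum.inl i)) := fun i => by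
    rw [Equiv.permCongr_apply]
    congr 2
    rw [Equiv.symm_apply_eq]; rfl
  have h5 : ∀ i, e.permCongr σ (lastIdx h i) = e (σ (Sum.inr i)) := fun i => by
    rw [Equiv.permCongr_apply]
    congr 2
    rw [Equiv.symm_apply_eq]; rfl
  simp only [h4, h5]
  rfl

/-- Extension of a permutation of the first `k` indices by the identity. -/
theorem exists_perm_first {k l j : ℕ} (h : k + l = j) (τ : Perm (Fin k)) :
    ∃ τ' : Perm (Fin j), rsign τ' = rsign τ ∧ (∀ i, τ' (firstIdx h i) = firstIdx h (τ i)) ∧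
      ∀ i, τ' (lastIdx h i) = lastIdx h i := by
  set e := finSumFinEquiv.trans (finCongr h) with he
  refine ⟨e.permCongr (Perm.sumCongr τ 1), ?_, fun i => ?_, fun i => ?_⟩
  · simp [rsign]
  · have : e.symm (firstIdx h i) = Sum.inl i := by rw [Equiv.symm_apply_eq]; rfl
    rw [Equiv.permCongr_apply, this]; rfl
  · have : e.symm (lastIdx h i) = Sum.inr i := by rw [Equiv.symm_apply_eq]; rfl
    rw [Equiv.permCongr_apply, this]; rfl

/-- Extension of a permutation of the last `l` indices by the identity. -/
theorem exists_perm_last {k l j : ℕ} (h : k + l = j) (τ : Perm (Fin l)) :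
    ∃ τ' : Perm (Fin j), rsign τ' = rsign τ ∧ (∀ i, τ' (firstIdx h i) = firstIdx h i) ∧
      ∀ i, τ' (lastIdx h i) = lastIdx h (τ i) := by
  set e := finSumFinEquiv.trans (finCongr h) with he
  refine ⟨e.permCongr (Perm.sumCongr 1 τ), ?_, fun i => ?_, fun i => ?_⟩
  · simp [rsign]
  · have : e.symm (firstIdx h i) = Sum.inl i := by rw [Equiv.symm_apply_eq]; rfl
    rw [Equiv.permCongr_apply, this]; rfl
  · have : e.symm (lastIdx h i) = Sum.inr i := by rw [Equiv.symm_apply_eq]; rfl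
    rw [Equiv.permCongr_apply, this]; rfl

theorem rsign_smul_sum_mul {j : ℕ} {F : Type*} [AddCommGroup F] [Module ℝ F]
    (f : Perm (Fin j) → F) (τ : Perm (Fin j)) :
    rsign τ • ∑ σ : Perm (Fin j), rsign σ • f (σ * τ) = ∑ σ : Perm (Fin j), rsign σ • f σ := by
  rw [← Equiv.sum_comp (Equiv.mulRight τ) (fun σ => rsign σ • f σ), Finset.smul_sum]
  refine Finset.sum_congr rfl fun σ _ => ?_
  rw [Equiv.coe_mulRight, rsign_mul, smul_smul, mul_comm]

/-- A permutation of the first block can be absorbed into the outer sum, so all k! inner terms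
contribute equally and cancel the k! in the denominator. With c = 1/(k! l!) this evaluates an
iterated product; both bracketings then have the constant 1/(k! l! p!), which gives associativity.
-/
theorem wedge_apply_of_left {n k l j : ℕ} (β : F₁ →L[ℝ] F₂ →L[ℝ] F₃) (h : k + l = j)
    (u : Form n k F₁) (v : Form n l F₂) (c : ℝ) (f : (Fin k → Space n) → F₁)
    (hu : ∀ y, u y = c • ∑ τ : Perm (Fin k), rsign τ • f (fun i => y (τ i)))
    (x : Fin j → Space n) :
    wedge β h u v x = (c * (l.factorial : ℝ)⁻¹) • ∑ σ : Perm (Fin j),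
      rsign σ • β (f fun i => x (σ (firstIdx h i))) (v fun i => x (σ (lastIdx h i))) := by
  have key : ∀ τ : Perm (Fin k), ∑ σ : Perm (Fin j), rsign σ • rsign τ •
      β (f fun i => x (σ (firstIdx h (τ i)))) (v fun i => x (σ (lastIdx h i))) =
      ∑ σ : Perm (Fin j),
      rsign σ • β (f fun i => x (σ (firstIdx h i))) (v fun i => x (σ (lastIdx h i))) := by
    intro τ
    obtain ⟨τ', h1, h2, h3⟩ := exists_perm_first h τ
    refine Eq.trans ?_ (rsign_smul_sum_mul _ τ')
    rw [Finset.smul_sum]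
    refine Finset.sum_congr rfl fun σ _ => ?_
    simp only [Perm.mul_apply, h2, h3, h1]
    rw [smul_comm]
  rw [wedge_apply]
  simp only [hu, map_smul, map_sum, _root_.smul_apply, _root_.sum_apply,
    smul_comm _ c, ← Finset.smul_sum]
  simp only [Finset.smul_sum (s := (Finset.univ : Finset (Perm (Fin k))))]
  rw [Finset.sum_comm]
  simp only [key, Finset.sum_const, Finset.card_univ, Fintype.card_perm, Fintype.card_fin]
  rw [← Nat.cast_smul_eq_nsmul ℝ, smul_smul, smul_smul]
  congr 1
  have : (k.factorial : ℝ) ≠ 0 := by positivity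
  push_cast
  field_simp

theorem wedge_apply_of_right {n k l j : ℕ} (β : F₁ →L[ℝ] F₂ →L[ℝ] F₃) (h : k + l = j)
    (u : Form n k F₁) (v : Form n l F₂) (c : ℝ) (f : (Fin l → Space n) → F₂)
    (hv : ∀ y, v y = c • ∑ τ : Perm (Fin l), rsign τ • f (fun i => y (τ i)))
    (x : Fin j → Space n) :
    wedge β h u v x = (c * (k.factorial : ℝ)⁻¹) • ∑ σ : Perm (Fin j),
      rsign σ • β (u fun i => x (σ (firstIdx h i))) (f fun i => x (σ (lastIdx h i))) := by
  have key : ∀ τ : Perm (Fin l), ∑ σ : Perm (Fin j), rsign σ • rsign τ •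
      β (u fun i => x (σ (firstIdx h i))) (f fun i => x (σ (lastIdx h (τ i)))) =
      ∑ σ : Perm (Fin j),
      rsign σ • β (u fun i => x (σ (firstIdx h i))) (f fun i => x (σ (lastIdx h i))) := by
    intro τ
    obtain ⟨τ', h1, h2, h3⟩ := exists_perm_last h τ
    refine Eq.trans ?_ (rsign_smul_sum_mul _ τ')
    rw [Finset.smul_sum]
    refine Finset.sum_congr rfl fun σ _ => ?_
    simp only [Perm.mul_apply, h2, h3, h1]
    rw [smul_comm]
  rw [wedge_apply]
  simp only [hv, map_smul, map_sum, smul_comm _ c, ← Finset.smul_sum]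
  simp only [Finset.smul_sum (s := (Finset.univ : Finset (Perm (Fin l))))]
  rw [Finset.sum_comm]
  simp only [key, Finset.sum_const, Finset.card_univ, Fintype.card_perm, Fintype.card_fin]
  rw [← Nat.cast_smul_eq_nsmul ℝ, smul_smul, smul_smul]
  congr 1
  have : (l.factorial : ℝ) ≠ 0 := by positivity
  push_cast
  field_simp

/-- Associativity of the exterior product. -/
theorem wedge_assoc {n k l p a b j : ℕ} {β₁ : F₁ →L[ℝ] F₂ →L[ℝ] F₄} {β₂ : F₄ →L[ℝ] F₃ →L[ℝ] F₅}
    {F₆ : Type*} [NormedAddCommGroup F₆] [NormedSpace ℝ F₆]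
    {β₃ : F₂ →L[ℝ] F₃ →L[ℝ] F₆} {β₄ : F₁ →L[ℝ] F₆ →L[ℝ] F₅}
    (hβ : ∀ x y z, β₂ (β₁ x y) z = β₄ x (β₃ y z))
    (hkl : k + l = a) (hap : a + p = j) (hlp : l + p = b) (hkb : k + b = j)
    (u : Form n k F₁) (v : Form n l F₂) (w : Form n p F₃) :
    wedge β₂ hap (wedge β₁ hkl u v) w = wedge β₄ hkb u (wedge β₃ hlp v w) := by
  ext x
  rw [wedge_apply_of_left β₂ hap _ w _
      (fun y => β₁ (u fun i => y (firstIdx hkl i)) (v fun i => y (lastIdx hkl i)))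
      (wedge_apply β₁ hkl u v),
    wedge_apply_of_right β₄ hkb u _ _
      (fun y => β₃ (v fun i => y (firstIdx hlp i)) (w fun i => y (lastIdx hlp i)))
      (wedge_apply β₃ hlp v w)]
  have e1 : ∀ i, firstIdx hap (firstIdx hkl i) = firstIdx hkb i := fun i => Fin.ext rfl
  have e2 : ∀ i, firstIdx hap (lastIdx hkl i) = lastIdx hkb (firstIdx hlp i) :=
    fun i => Fin.ext rfl
  have e3 : ∀ i, lastIdx hap i = lastIdx hkb (lastIdx hlp i) := fun i => Fin.ext (by
    simp only [val_lastIdx]; omega)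
  simp only [hβ, e1, e2, e3]
  congr 1
  push_cast
  rw [mul_inv, mul_inv]; ring

theorem val_finRotate_pow {j : ℕ} (a : ℕ) (i : Fin j) :
    (((finRotate j) ^ a) i : ℕ) = (i + a) % j := by
  rcases j with _ | j
  · exact i.elim0
  induction a with
  | zero => simp [Nat.mod_eq_of_lt i.2]
  | succ a ih =>
    rw [pow_succ', Perm.mul_apply, finRotate_apply, Fin.val_add, ih]
    simp [Nat.add_mod, ← add_assoc]

/-- One rotation has sign (-1)^(l + k - 1). Its l-th power has exponent l(l - 1) + kl, and l(l - 1)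
is even. -/
theorem rsign_finRotate_pow (k l : ℕ) :
    rsign ((finRotate (l + k)) ^ l) = (-1) ^ (k * l) := by
  simp only [rsign, map_pow, sign_finRotate]
  push_cast
  rw [← pow_mul]
  rcases l with _ | l
  · simp
  have h : (l + 1 + k - 1) * (l + 1) = l * (l + 1) + k * (l + 1) := by
    rw [show l + 1 + k - 1 = l + k by omega]; ring
  rw [h, pow_add, (Nat.even_mul_succ_self l).neg_one_pow, one_mul]

/-- Graded commutativity of the exterior product. -/
theorem wedge_comm {n k l j : ℕ} (β : F₁ →L[ℝ] F₂ →L[ℝ] F₃) (h : k + l = j) (h' : l + k = j)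
    (u : Form n k F₁) (v : Form n l F₂) :
    wedge β h u v = (-1 : ℝ) ^ (k * l) • wedge β.flip h' v u := by
  subst h'
  ext x
  rw [ContinuousAlternatingMap.smul_apply, wedge_apply, wedge_apply, mul_comm k.factorial,
    smul_comm, ← rsign_smul_sum_mul _ ((finRotate (l + k)) ^ l), rsign_finRotate_pow]
  congr 2
  refine Finset.sum_congr rfl fun σ _ => ?_
  -- Rotation by l places exchanges the two blocks of indices.
  have e1 : ∀ i : Fin k, ((finRotate (l + k)) ^ l) (firstIdx h i) = lastIdx rfl i := fun i =>
    Fin.ext (by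
      rw [val_finRotate_pow, val_firstIdx, val_lastIdx, Nat.mod_eq_of_lt] <;> omega)
  have e2 : ∀ i : Fin l, ((finRotate (l + k)) ^ l) (lastIdx h i) = firstIdx rfl i := fun i =>
    Fin.ext (by
      rw [val_finRotate_pow, val_firstIdx, val_lastIdx,
        show k + (i : ℕ) + l = i + (l + k) by omega, Nat.add_mod_right, Nat.mod_eq_of_lt]
      omega)
  simp only [Perm.mul_apply, e1, e2, ContinuousLinearMap.flip_apply]

/-- A covector as a real `1`-form. -/
def oneForm {n : ℕ} (a : Space n →L[ℝ] ℝ) : Form n 1 ℝ :=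
  ContinuousAlternatingMap.ofSubsingleton ℝ (Space n) ℝ (0 : Fin 1) a

theorem oneForm_apply {n : ℕ} (a : Space n →L[ℝ] ℝ) (x : Fin 1 → Space n) :
    oneForm a x = a (x 0) := rfl

/-- The exterior product of a covector and a form as an alternating sum. -/
theorem alternatizeUncurryFin_smulRight {n k : ℕ} (h : 1 + k = k + 1) (a : Space n →L[ℝ] ℝ)
    (b : Form n k F₁) :
    ContinuousAlternatingMap.alternatizeUncurryFin (a.smulRight b) =
      wedge (ContinuousLinearMap.lsmul ℝ ℝ) h (oneForm a) b := by
  ext x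
  set f := ContinuousAlternatingMap.alternatizeUncurryFin (a.smulRight b) with hf
  have hx : ∀ y, f y = ∑ i : Fin (k + 1), (-1 : ℝ) ^ (i : ℕ) • a (y i) • b (i.removeNth y) := by
    intro y
    rw [hf, ContinuousAlternatingMap.alternatizeUncurryFin_apply]
    refine Finset.sum_congr rfl fun i _ => ?_
    rcases Nat.even_or_odd (i : ℕ) with hi | hi <;> simp [hi.neg_one_pow]
  -- The antisymmetrization of f is computed twice. As f is alternating, it is (k + 1)! f; expanding
  -- f into its k + 1 terms, it is k + 1 times the permutation sum of the exterior product.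
  -- Cancelling k + 1 leaves the normalization k!.
  have h1 : ∑ σ : Perm (Fin (k + 1)), rsign σ • f (fun i => x (σ i)) =
      ((k + 1).factorial : ℝ) • f x := by
    have : ∀ σ : Perm (Fin (k + 1)), rsign σ • f (fun i => x (σ i)) = f x := by
      intro σ
      have := f.toAlternatingMap.map_perm x σ
      rw [Units.smul_def, ← Int.cast_smul_eq_zsmul ℝ] at this
      change f (fun i => x (σ i)) = rsign σ • f x at this
      rw [this, smul_smul, rsign_mul_self, one_smul]
    rw [Finset.sum_congr rfl fun σ _ => this σ]
    simp [Fintype.card_perm, ← Nat.cast_smul_eq_nsmul ℝ]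
  have h2 : ∑ σ : Perm (Fin (k + 1)), rsign σ • f (fun i => x (σ i)) = ((k + 1 : ℕ) : ℝ) •
      ∑ σ : Perm (Fin (k + 1)), rsign σ • (a (x (σ 0)) • b (fun i => x (σ i.succ))) := by
    simp only [hx, Finset.smul_sum (s := (Finset.univ : Finset (Fin (k + 1))))]
    rw [Finset.sum_comm]
    -- The cycle that brings the i-th argument to the front has sign (-1)^i, which cancels the sign
    -- of the i-th term.
    have : ∀ i : Fin (k + 1), ∑ σ : Perm (Fin (k + 1)), rsign σ • (-1 : ℝ) ^ (i : ℕ) •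
        a (x (σ i)) • b (i.removeNth fun i => x (σ i)) =
        ∑ σ : Perm (Fin (k + 1)), rsign σ • (a (x (σ 0)) • b (fun i => x (σ i.succ))) := by
      intro i
      refine Eq.trans ?_ (rsign_smul_sum_mul _ i.cycleRange.symm)
      rw [Finset.smul_sum]
      refine Finset.sum_congr rfl fun σ _ => ?_
      have hs : rsign i.cycleRange.symm = (-1) ^ (i : ℕ) := by
        simp [rsign]
      rw [smul_comm, hs]
      simp only [Perm.mul_apply, Fin.cycleRange_symm_zero, Fin.cycleRange_symm_succ]
      rfl
    simp [this, ← Nat.cast_smul_eq_nsmul ℝ]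
  rw [h2, Nat.factorial_succ, Nat.cast_mul, mul_smul] at h1
  have h3 := (smul_right_injective F₁ (r := ((k + 1 : ℕ) : ℝ)) (by positivity)) h1
  rw [wedge_apply, eq_inv_smul_iff₀ (by positivity)]
  simp only [Nat.factorial_one, one_mul]
  rw [← h3]
  refine Finset.sum_congr rfl fun σ _ => ?_
  rw [oneForm_apply]
  have e1 : firstIdx h 0 = 0 := Fin.ext rfl
  have e2 : ∀ i : Fin k, lastIdx h i = i.succ := fun i => Fin.ext (by
    simp [val_lastIdx, add_comm])
  simp only [e1, e2, ContinuousLinearMap.lsmul_apply]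

theorem wedge_apply_zero_right {n k : ℕ} (β : F₁ →L[ℝ] F₂ →L[ℝ] F₃) (h : k + 0 = k)
    (u : Form n k F₁) (v : Form n 0 F₂) (x : Fin k → Space n) :
    wedge β h u v x = β (u x) (v fun i => i.elim0) := by
  rw [wedge_apply, inv_smul_eq_iff₀ (by positivity)]
  have : ∀ σ : Perm (Fin k), rsign σ •
      β (u fun i => x (σ (firstIdx h i))) (v fun i => x (σ (lastIdx h i))) =
      β (u x) (v fun i => i.elim0) := by
    intro σ
    have h1 := u.toAlternatingMap.map_perm x σ
    rw [Units.smul_def, ← Int.cast_smul_eq_zsmul ℝ] at h1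
    change u (fun i => x (σ i)) = rsign σ • u x at h1
    have h2 : (fun i => x (σ (lastIdx h i))) = fun i => i.elim0 := funext fun i => i.elim0
    have h3 : ∀ i, firstIdx h i = i := fun i => rfl
    simp only [h3]
    rw [h1, h2, map_smul, _root_.smul_apply, smul_smul, rsign_mul_self, one_smul]
  simp [this, Fintype.card_perm, ← Nat.cast_smul_eq_nsmul ℝ]

theorem norm_wedge_le {n k l j : ℕ} (β : F₁ →L[ℝ] F₂ →L[ℝ] F₃) (h : k + l = j)
    (u : Form n k F₁) (v : Form n l F₂) :
    ‖wedge β h u v‖ ≤ j.factorial * ‖β‖ * ‖u‖ * ‖v‖ := by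
  refine ContinuousAlternatingMap.opNorm_le_bound _ (by positivity) fun x => ?_
  have key : ∀ σ : Perm (Fin j), ‖rsign σ •
      β (u fun i => x (σ (firstIdx h i))) (v fun i => x (σ (lastIdx h i)))‖ ≤
      ‖β‖ * ‖u‖ * ‖v‖ * ∏ i, ‖x i‖ := by
    intro σ
    have h1 := u.le_opNorm fun i => x (σ (firstIdx h i))
    have h2 := v.le_opNorm fun i => x (σ (lastIdx h i))
    have h3 : ∏ i, ‖x i‖ = (∏ i, ‖x (σ (firstIdx h i))‖) * ∏ i, ‖x (σ (lastIdx h i))‖ := by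
      subst h
      rw [← Equiv.prod_comp σ, Fin.prod_univ_add]; rfl
    rw [norm_smul, Real.norm_eq_abs, abs_rsign, one_mul, h3]
    calc _ ≤ ‖β‖ * ‖u fun i => x (σ (firstIdx h i))‖ * ‖v fun i => x (σ (lastIdx h i))‖ :=
          β.le_opNorm₂ _ _
      _ ≤ ‖β‖ * (‖u‖ * ∏ i, ‖x (σ (firstIdx h i))‖) * (‖v‖ * ∏ i, ‖x (σ (lastIdx h i))‖) := by
          gcongr
      _ = _ := by ring
  rw [wedge_apply, norm_smul]
  have h4 := norm_sum_le_of_le Finset.univ (fun σ (_ : σ ∈ Finset.univ) => key σ)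
  simp only [Finset.sum_const, Finset.card_univ, Fintype.card_perm, Fintype.card_fin,
    nsmul_eq_mul] at h4
  have h5 : ‖((k.factorial * l.factorial : ℕ) : ℝ)⁻¹‖ ≤ 1 := by
    rw [norm_inv, Real.norm_natCast]
    refine inv_le_one_of_one_le₀ ?_
    exact_mod_cast Nat.mul_pos k.factorial_pos l.factorial_pos
  calc _ ≤ 1 * (j.factorial * (‖β‖ * ‖u‖ * ‖v‖ * ∏ i, ‖x i‖)) := by gcongr
    _ = _ := by ring

/-- The exterior product as a continuous bilinear map. -/
def wedgeL (n : ℕ) {k l j : ℕ} (β : F₁ →L[ℝ] F₂ →L[ℝ] F₃) (h : k + l = j) :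
    Form n k F₁ →L[ℝ] Form n l F₂ →L[ℝ] Form n j F₃ :=
  LinearMap.mkContinuous₂ (LinearMap.mk₂ ℝ (wedge β h)
    (fun u u' v => by
      ext x
      simp [wedge_apply, smul_add, Finset.sum_add_distrib])
    (fun c u v => by
      ext x
      simp [wedge_apply, smul_comm _ c, ← Finset.smul_sum])
    (fun u v v' => by
      ext x
      simp [wedge_apply, smul_add, Finset.sum_add_distrib])
    (fun c u v => by
      ext x
      simp [wedge_apply, smul_comm _ c, ← Finset.smul_sum]))
    (j.factorial * ‖β‖) (norm_wedge_le β h)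

theorem wedgeL_apply {n k l j : ℕ} (β : F₁ →L[ℝ] F₂ →L[ℝ] F₃) (h : k + l = j)
    (u : Form n k F₁) (v : Form n l F₂) : wedgeL n β h u v = wedge β h u v := rfl

end WedgeAlgebra

/-! ### The pairing of complementary degrees and its nondegeneracy. -/

section Pairing

variable {g : Type*} [NormedAddCommGroup g] [InnerProductSpace ℝ g] {n : ℕ}

/-- The pairing of forms of complementary degrees as a continuous bilinear map. -/
def pairL (g : Type*) [NormedAddCommGroup g] [InnerProductSpace ℝ g] {n k l : ℕ} (h : k + l = n) :
    Form n k g →L[ℝ] Form n l g →L[ℝ] ℝ :=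
  (ContinuousLinearMap.compL ℝ (Form n l g) (Form n n ℝ) ℝ
    (ContinuousAlternatingMap.apply ℝ (Space n) ℝ fun i => EuclideanSpace.single i 1)) ∘L
      wedgeL n (innerSL ℝ) h

theorem pairL_apply {k l : ℕ} (h : k + l = n) (u : Form n k g) (v : Form n l g) :
    pairL g h u v = pair h u v := rfl

theorem pair_comm {k l : ℕ} (h : k + l = n) (h' : l + k = n) (u : Form n k g) (v : Form n l g) :
    pair h u v = (-1) ^ (k * l) * pair h' v u := by
  have : (innerSL ℝ : g →L[ℝ] g →L[ℝ] ℝ).flip = innerSL ℝ := by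
    ext x y
    simp
  rw [pair, wedge_comm _ h h', this]
  rfl

/-- `λ ∧ a ∧ b = (-1)ᵏ a ∧ λ ∧ b`. -/
theorem pair_alternatizeUncurryFin_smulRight {k l : ℕ} (h : k + 1 + l = n) (h' : k + (l + 1) = n)
    (c : Space n →L[ℝ] ℝ) (a : Form n k g) (b : Form n l g) :
    pair h (ContinuousAlternatingMap.alternatizeUncurryFin (c.smulRight a)) b =
      (-1) ^ k * pair h' a (ContinuousAlternatingMap.alternatizeUncurryFin (c.smulRight b)) := by
  rw [alternatizeUncurryFin_smulRight (by omega), alternatizeUncurryFin_smulRight (by omega),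
    wedge_comm _ _ rfl]
  have h1 := wedge_assoc (n := n) (β₁ := (ContinuousLinearMap.lsmul ℝ ℝ : ℝ →L[ℝ] g →L[ℝ] g).flip)
    (β₂ := innerSL ℝ) (β₃ := (ContinuousLinearMap.lsmul ℝ ℝ : ℝ →L[ℝ] g →L[ℝ] g))
    (β₄ := innerSL ℝ) (fun x y z => by simp)
    rfl h (add_comm 1 l) h' a (oneForm c) b
  rw [pair, pair, ← h1, one_mul, ← wedgeL_apply (innerSL ℝ), map_smul,
    _root_.smul_apply]
  rfl

/-- Since k < n, every k-tuple of basis vectors misses some e_i. Evaluating dx_i ∧ w on that tuple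
preceded by e_i leaves only the value of w on the tuple. -/
theorem eq_zero_of_alternatizeUncurryFin_smulRight {k : ℕ} (hk : k < n) (w : Form n k g)
    (hw : ∀ c : Space n →L[ℝ] ℝ,
      ContinuousAlternatingMap.alternatizeUncurryFin (c.smulRight w) = 0) : w = 0 := by
  apply ContinuousAlternatingMap.toAlternatingMap_injective
  refine Module.Basis.ext_alternating (EuclideanSpace.basisFun (Fin n) ℝ).toBasis fun s _ => ?_
  obtain ⟨i, hi⟩ : ∃ i, i ∉ Set.range s := by
    by_contra! hcon
    have := Fintype.card_le_of_surjective s hcon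
    simp at this; omega
  have h1 := congrArg (fun f => f (Fin.cons (EuclideanSpace.single i 1)
    (fun j => EuclideanSpace.single (s j) 1))) (hw (EuclideanSpace.proj i))
  simp only [ContinuousAlternatingMap.alternatizeUncurryFin_apply] at h1
  rw [Fin.sum_univ_succ] at h1
  have h2 : ∀ j, i ≠ s j := fun j h => hi ⟨j, h.symm⟩
  simpa [h2] using h1

/-- The pairing of forms of complementary degrees is nondegenerate. -/
theorem eq_zero_of_pair_eq_zero {l : ℕ} : ∀ {k : ℕ} (h : k + l = n) (w : Form n k g),
    (∀ b : Form n l g, pair h w b = 0) → w = 0 := by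
  -- In top degree, pairing with the constant w(e₁, …, eₙ) gives its squared norm. Otherwise the
  -- pairing of c ∧ w with b is, up to sign, that of w with c ∧ b, so c ∧ w = 0 by induction for
  -- every covector c, whence w = 0.
  induction l with
  | zero =>
    intro k h w hw
    obtain rfl : k = n := by omega
    set e : Fin k → Space k := fun i => EuclideanSpace.single i 1 with he
    have h0 : w e = 0 := by
      have h1 := hw (ContinuousAlternatingMap.constOfIsEmpty ℝ (Space k) (Fin 0) (w e))
      rw [pair, coeff, wedge_apply_zero_right] at h1
      exact (inner_self_eq_zero (𝕜 := ℝ)).1 h1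
    apply ContinuousAlternatingMap.toAlternatingMap_injective
    refine Module.Basis.ext_alternating (EuclideanSpace.basisFun (Fin k) ℝ).toBasis fun s hs => ?_
    have h1 := w.toAlternatingMap.map_perm e
      (Equiv.ofBijective s (Finite.injective_iff_bijective.1 hs))
    have h2 : w.toAlternatingMap e = 0 := h0
    rw [h2, smul_zero] at h1
    simpa [he, Function.comp_def] using h1
  | succ l ih =>
    intro k h w hw
    refine eq_zero_of_alternatizeUncurryFin_smulRight (by omega) w fun c => ?_
    refine ih (by omega) _ fun b => ?_
    rw [pair_alternatizeUncurryFin_smulRight (by omega) h, hw, mul_zero]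

end Pairing

/-! ### Graded antisymmetry and invariance for Lie-algebra-valued forms. -/

section Lie

variable {g : Type*} [NormedLieRing g] [InvariantLieAlgebra g] [FiniteDimensional ℝ g] {n : ℕ}

theorem bracketL_apply (x y : g) : bracketL g x y = ⁅x, y⁆ := rfl

theorem brk_comm {k l j : ℕ} (h : k + l = j) (h' : l + k = j) (u : Form n k g) (v : Form n l g) :
    brk h u v = -((-1 : ℝ) ^ (k * l) • brk h' v u) := by
  have : (bracketL g).flip = -bracketL g := by
    ext x y
    simp only [ContinuousLinearMap.flip_apply, _root_.neg_apply, bracketL_apply, lie_skew]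
  rw [brk, wedge_comm _ h h', this, brk, ← smul_neg]
  congr 1
  ext x
  simp [wedge_apply]

/-- Invariance of the inner product, for forms. -/
theorem pair_brk {k l p a b : ℕ} (hkl : k + l = a) (hap : a + p = n) (hlp : l + p = b)
    (hkb : k + b = n) (u : Form n k g) (v : Form n l g) (w : Form n p g) :
    pair hap (brk hkl u v) w = pair hkb u (brk hlp v w) := by
  have h : ∀ x y z : g, innerSL ℝ (bracketL g x y) z = innerSL ℝ x (bracketL g y z) := by
    intro x y z
    simp only [bracketL_apply, innerSL_apply_apply]
    have := InvariantLieAlgebra.invariant y x z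
    rw [← lie_skew, inner_neg_left]
    linarith
  exact congrArg coeff (wedge_assoc h hkl hap hlp hkb u v w)

end Lie

/-! ### Weak exterior derivatives -/

section WeakD

variable {g : Type*} [NormedAddCommGroup g] [InnerProductSpace ℝ g] {n : ℕ}

theorem extDeriv_eq_zero_of_notMem_tsupport {k : ℕ} {η : Space n → Form n k g} {x : Space n}
    (hx : x ∉ tsupport η) : extDeriv η x = 0 := by
  have : fderiv ℝ η x = 0 := by
    by_contra hne
    exact hx (support_fderiv_subset ℝ hne)
  rw [extDeriv, this]
  exact map_zero (ContinuousAlternatingMap.alternatizeUncurryFinCLM ℝ (Space n) g)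

theorem continuous_extDeriv {k : ℕ} {η : Space n → Form n k g} (hη : ContDiff ℝ ∞ η) :
    Continuous (extDeriv η) :=
  (ContinuousAlternatingMap.alternatizeUncurryFinCLM ℝ (Space n) g).continuous.comp
    (hη.continuous_fderiv (by simp))

theorem hasCompactSupport_extDeriv {k : ℕ} {η : Space n → Form n k g}
    (hη : HasCompactSupport η) : HasCompactSupport (extDeriv η) :=
  HasCompactSupport.intro hη fun _ hx => extDeriv_eq_zero_of_notMem_tsupport hx

/-- Coordinate expression of the exterior derivative. -/
theorem extDeriv_eq_sum {k : ℕ} (η : Space n → Form n k g) (x : Space n) :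
    extDeriv η x = ∑ i, ContinuousAlternatingMap.alternatizeUncurryFin
      ((EuclideanSpace.proj i : Space n →L[ℝ] ℝ).smulRight
        (fderiv ℝ η x (EuclideanSpace.single i 1))) := by
  have h : fderiv ℝ η x = ∑ i, (EuclideanSpace.proj i : Space n →L[ℝ] ℝ).smulRight
      (fderiv ℝ η x (EuclideanSpace.single i 1)) := by
    ext1 y
    conv_lhs => rw [← (EuclideanSpace.basisFun (Fin n) ℝ).sum_repr y, map_sum]
    simp [_root_.sum_apply]
  rw [extDeriv]
  conv_lhs => rw [h]
  exact (map_sum (ContinuousAlternatingMap.alternatizeUncurryFinCLM ℝ (Space n) g) _ _)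

/-- Stokes' theorem for smooth forms, one of them with compact support. -/
theorem integral_pair_extDeriv {k l : ℕ} (h : k + 1 + l = n) (h' : k + (l + 1) = n)
    {η : Space n → Form n k g} {ζ : Space n → Form n l g} (hη : ContDiff ℝ ∞ η)
    (hζ : ContDiff ℝ ∞ ζ) (hc : HasCompactSupport ζ) :
    ∫ x, (pair h (extDeriv η x) (ζ x) + (-1) ^ k * pair h' (η x) (extDeriv ζ x)) = 0 := by
  set e : Fin n → Space n := fun i => EuclideanSpace.single i 1
  -- `B i a b` is the coefficient of ⟨dx_i ∧ a ∧ b⟩. In these terms the integrand is the sum over i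
  -- of the product rule for ∂_i of `B i η ζ`, so Stokes reduces to integration by parts in each
  -- coordinate.
  let B : Fin n → Form n k g →L[ℝ] Form n l g →L[ℝ] ℝ := fun i =>
    (pairL g h) ∘L (ContinuousAlternatingMap.alternatizeUncurryFinCLM ℝ (Space n) g ∘L
      ContinuousLinearMap.smulRightL ℝ (Space n) (Form n k g) (EuclideanSpace.proj i))
  have hB : ∀ i a b, B i a b = pair h (ContinuousAlternatingMap.alternatizeUncurryFin
      ((EuclideanSpace.proj i : Space n →L[ℝ] ℝ).smulRight a)) b := fun i a b => rfl
  have h1 : ∀ x, pair h (extDeriv η x) (ζ x) = ∑ i, B i (fderiv ℝ η x (e i)) (ζ x) := by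
    intro x
    rw [← pairL_apply, extDeriv_eq_sum, map_sum, _root_.sum_apply]
    rfl
  have h2 : ∀ x, (-1) ^ k * pair h' (η x) (extDeriv ζ x) =
      ∑ i, B i (η x) (fderiv ℝ ζ x (e i)) := by
    intro x
    rw [← pairL_apply, extDeriv_eq_sum, map_sum, Finset.mul_sum]
    refine Finset.sum_congr rfl fun i _ => ?_
    rw [hB, pair_alternatizeUncurryFin_smulRight h h', pairL_apply]
  have cη := hη.continuous
  have cζ := hζ.continuous
  have cη' : Continuous (fderiv ℝ η) := hη.continuous_fderiv (by simp)
  have cζ' : Continuous (fderiv ℝ ζ) := hζ.continuous_fderiv (by simp)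
  have i1 : ∀ i, Integrable fun x => B i (fderiv ℝ η x (e i)) (ζ x) := fun i =>
    Continuous.integrable_of_hasCompactSupport (by fun_prop)
      (hc.mono fun x hx => by
        contrapose! hx
        simp only [Function.mem_support, not_not] at hx ⊢
        rw [hx, map_zero])
  have i2 : ∀ i, Integrable fun x => B i (η x) (fderiv ℝ ζ x (e i)) := fun i =>
    Continuous.integrable_of_hasCompactSupport (by fun_prop)
      ((hc.fderiv ℝ).mono fun x hx => by
        contrapose! hx
        simp only [Function.mem_support, not_not] at hx ⊢
        rw [hx, _root_.zero_apply, map_zero])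
  have i3 : ∀ i, Integrable fun x => B i (η x) (ζ x) := fun i =>
    Continuous.integrable_of_hasCompactSupport (by fun_prop)
      (hc.mono fun x hx => by
        contrapose! hx
        simp only [Function.mem_support, not_not] at hx ⊢
        rw [hx, map_zero])
  simp only [h1, h2]
  rw [integral_add (integrable_finsetSum _ fun i _ => i1 i)
    (integrable_finsetSum _ fun i _ => i2 i), integral_finsetSum _ fun i _ => i1 i,
    integral_finsetSum _ fun i _ => i2 i, ← Finset.sum_add_distrib]
  refine Finset.sum_eq_zero fun i _ => ?_
  rw [integral_bilinear_fderiv_right_eq_neg_left_of_integrable (i1 i) (i2 i) (i3 i)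
    (fun x _ => (hη.differentiable (by simp)) x) (fun x _ => (hζ.differentiable (by simp)) x)]
  ring

/-- Test forms vanish outside their support, so the set of integration may be changed; this makes
restriction of weak derivatives to smaller sets immediate. -/
theorem bdryInt_eq_integral {k l : ℕ} (h : k + 1 + l = n) {U : Set (Space n)}
    {u : Space n → Form n k g} {w : Space n → Form n (k + 1) g} {η : Space n → Form n l g}
    (hη : tsupport η ⊆ U) :
    bdryInt h U u w η (extDeriv η) = ∫ x, (pair h (w x) (η x) +
      (-1) ^ k * pair (by omega : k + (l + 1) = n) (u x) (extDeriv η x)) := by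
  refine setIntegral_eq_integral_of_forall_compl_eq_zero fun x hx => ?_
  have hx' : x ∉ tsupport η := fun h => hx (hη h)
  rw [extDeriv_eq_zero_of_notMem_tsupport hx', image_eq_zero_of_notMem_tsupport hx',
    ← pairL_apply, ← pairL_apply]
  simp

theorem IsWeakD.mono {k : ℕ} {U V : Set (Space n)} {u : Space n → Form n k g}
    {w : Space n → Form n (k + 1) g} (hw : IsWeakD V u w) (hUV : U ⊆ V) : IsWeakD U u w := by
  intro l h η h1 h2 h3
  rw [bdryInt_eq_integral h h3, ← bdryInt_eq_integral h (h3.trans hUV)]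
  exact hw l h η h1 h2 (h3.trans hUV)

theorem bdryInt_congr {k l : ℕ} (h : k + 1 + l = n) {U : Set (Space n)}
    {u u' : Space n → Form n k g} {w w' : Space n → Form n (k + 1) g}
    {v v' : Space n → Form n l g} {z z' : Space n → Form n (l + 1) g}
    (hu : u =ᵐ[volume.restrict U] u') (hw : w =ᵐ[volume.restrict U] w')
    (hv : v =ᵐ[volume.restrict U] v') (hz : z =ᵐ[volume.restrict U] z') :
    bdryInt h U u w v z = bdryInt h U u' w' v' z' := by
  refine integral_congr_ae ?_
  filter_upwards [hu, hw, hv, hz] with x h1 h2 h3 h4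
  rw [h1, h2, h3, h4]

theorem IsWeakD.congr {k : ℕ} {U : Set (Space n)} {u u' : Space n → Form n k g}
    {w w' : Space n → Form n (k + 1) g} (h : IsWeakD U u w)
    (hu : u =ᵐ[volume.restrict U] u') (hw : w =ᵐ[volume.restrict U] w') : IsWeakD U u' w' := by
  intro l hl η h1 h2 h3
  rw [← bdryInt_congr hl hu hw (ae_eq_refl _) (ae_eq_refl _)]
  exact h l hl η h1 h2 h3

/-- The exterior derivative of a smooth form is a weak exterior derivative. -/
theorem isWeakD_extDeriv {k : ℕ} (U : Set (Space n)) {η : Space n → Form n k g}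
    (hη : ContDiff ℝ ∞ η) : IsWeakD U η (extDeriv η) := by
  intro l h ζ h1 h2 h3
  rw [bdryInt_eq_integral h h3]
  exact integral_pair_extDeriv h _ hη h1 h2

theorem bdryInt_comm {k l : ℕ} (h : k + 1 + l = n) (h' : l + 1 + k = n) (U : Set (Space n))
    (u : Space n → Form n k g) (w : Space n → Form n (k + 1) g)
    (v : Space n → Form n l g) (z : Space n → Form n (l + 1) g) :
    bdryInt h U u w v z = (-1) ^ (k * l) * bdryInt h' U v z u w := by
  rw [bdryInt, bdryInt, ← integral_const_mul]
  congr 1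
  ext x
  rw [pair_comm h (by omega) (w x) (v x), pair_comm _ h' (u x) (z x)]
  have e1 : ((-1 : ℝ)) ^ k * (-1) ^ (k * (l + 1)) = (-1) ^ (k * l) := by
    rw [← pow_add, show k + k * (l + 1) = k * l + 2 * k by ring, pow_add, pow_mul (-1 : ℝ) 2]
    simp
  have e2 : ((-1 : ℝ)) ^ ((k + 1) * l) = (-1) ^ (k * l) * (-1) ^ l := by
    rw [← pow_add]; ring_nf
  rw [← mul_assoc, e1, e2]
  ring

/-- Symmetric form of the definition of the weak exterior derivative. -/
theorem isWeakD_iff {k l : ℕ} (h : l + 1 + k = n) {U : Set (Space n)} {u : Space n → Form n k g}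
    {w : Space n → Form n (k + 1) g} : IsWeakD U u w ↔
      ∀ η : Space n → Form n l g, ContDiff ℝ ∞ η → HasCompactSupport η → tsupport η ⊆ U →
        bdryInt h U η (extDeriv η) u w = 0 := by
  constructor
  · intro hw η h1 h2 h3
    rw [bdryInt_comm h (by omega), hw l (by omega) η h1 h2 h3, mul_zero]
  · intro hw l' h' η h1 h2 h3
    obtain rfl : l' = l := by omega
    rw [bdryInt_comm h' h, hw η h1 h2 h3, mul_zero]

/-- The fundamental lemma of the calculus of variations, for a bilinear pairing. -/
theorem ae_bilin_eq_zero {E₁ E₂ : Type*} [NormedAddCommGroup E₁] [NormedSpace ℝ E₁]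
    [NormedAddCommGroup E₂] [NormedSpace ℝ E₂] (B : E₁ →L[ℝ] E₂ →L[ℝ] ℝ) {U : Set (Space n)}
    (hU : IsOpen U) {f : Space n → E₁} (hf : IntegrableOn f U)
    (h : ∀ ψ : Space n → ℝ, ContDiff ℝ ∞ ψ → HasCompactSupport ψ → tsupport ψ ⊆ U →
      ∀ b : E₂, ∫ x in U, B (f x) (ψ x • b) = 0) : ∀ᵐ x, x ∈ U → B (f x) = 0 := by
  have i0 : IntegrableOn (fun x => B (f x)) U := B.integrable_comp hf
  refine hU.ae_eq_zero_of_integral_contDiff_smul_eq_zero i0.locallyIntegrableOn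
    fun ψ h1 h2 h3 => ?_
  rw [← setIntegral_eq_integral_of_forall_compl_eq_zero (s := U) fun x hx => by
    rw [image_eq_zero_of_notMem_tsupport fun h => hx (h3 h), zero_smul]]
  obtain ⟨C, hC⟩ := h2.exists_bound_of_continuous h1.continuous
  have i1 : IntegrableOn (fun x => ψ x • B (f x)) U :=
    i0.bdd_smul C h1.continuous.aestronglyMeasurable (.of_forall hC)
  ext b
  rw [ContinuousLinearMap.integral_apply i1, _root_.zero_apply, ← h ψ h1 h2 h3 b]
  simp

/-- Uniqueness of the weak exterior derivative. -/
theorem IsWeakD.ae_eq {k l : ℕ} (h : k + 1 + l = n) {U : Set (Space n)} (hU : IsOpen U)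
    {u : Space n → Form n k g} {w w' : Space n → Form n (k + 1) g}
    (hw : IsWeakD U u w) (hw' : IsWeakD U u w') (iu : IntegrableOn u U) (iw : IntegrableOn w U)
    (iw' : IntegrableOn w' U) : w =ᵐ[volume.restrict U] w' := by
  -- Both candidates are tested with the same ψ b. The terms containing the exterior derivative of ψ
  -- b coincide and drop out of the difference.
  have key : ∀ᵐ x, x ∈ U → pairL g h (w x - w' x) = 0 := by
    refine ae_bilin_eq_zero (pairL g h) hU (iw.sub iw') fun ψ h1 h2 h3 b => ?_
    have hη : ContDiff ℝ ∞ fun x => ψ x • b := h1.smul contDiff_const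
    have hηc : HasCompactSupport fun x => ψ x • b := h2.smul_right
    have hηU : tsupport (fun x => ψ x • b) ⊆ U :=
      (tsupport_smul_subset_left ψ fun _ => b).trans h3
    have e1 := hw l h _ hη hηc hηU
    have e2 := hw' l h _ hη hηc hηU
    obtain ⟨C1, hC1⟩ := hηc.exists_bound_of_continuous hη.continuous
    obtain ⟨C2, hC2⟩ :=
      (hasCompactSupport_extDeriv hηc).exists_bound_of_continuous (continuous_extDeriv hη)
    have j1 := (pairL g h).integrable_of_bilin_of_bdd_right C1 iw
      hη.continuous.aestronglyMeasurable (.of_forall hC1)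
    have j2 := (pairL g h).integrable_of_bilin_of_bdd_right C1 iw'
      hη.continuous.aestronglyMeasurable (.of_forall hC1)
    have j3 := ((pairL g (by omega : k + (l + 1) = n)).integrable_of_bilin_of_bdd_right C2 iu
      (continuous_extDeriv hη).aestronglyMeasurable (.of_forall hC2)).const_mul ((-1) ^ k)
    have e3 := integral_sub (j1.add j3) (j2.add j3)
    have e4 : ∫ x in U, (pairL g h (w x) (ψ x • b) + (-1) ^ k *
        pairL g (by omega : k + (l + 1) = n) (u x) (extDeriv (fun x => ψ x • b) x)) = 0 := e1
    have e5 : ∫ x in U, (pairL g h (w' x) (ψ x • b) + (-1) ^ k *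
        pairL g (by omega : k + (l + 1) = n) (u x) (extDeriv (fun x => ψ x • b) x)) = 0 := e2
    simp only [Pi.add_apply] at e3
    rw [e4, e5, sub_zero] at e3
    rw [← e3]
    congr 1
    ext x
    simp only [map_sub, _root_.sub_apply, map_smul, smul_eq_mul]
    ring
  rw [Filter.EventuallyEq, ae_restrict_iff' hU.measurableSet]
  filter_upwards [key] with x hx hxU
  refine sub_eq_zero.1 (eq_zero_of_pair_eq_zero h _ fun b => ?_)
  rw [← pairL_apply, hx hxU, _root_.zero_apply]

/-- A smooth form with compact support represents an element of every space of forms. -/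
theorem exists_formPair_of_contDiff (Ω : Set (Space n)) {k : ℕ} (p q : ℝ≥0∞)
    {η : Space n → Form n k g} (hη : ContDiff ℝ ∞ η) (hc : HasCompactSupport η) :
    ∃ P : FormPair g Ω k p q, P.1 =ᵐ[volume.restrict Ω] η ∧
      P.2 =ᵐ[volume.restrict Ω] extDeriv η := by
  have h1 : MemLp η p (volume.restrict Ω) := hη.continuous.memLp_of_hasCompactSupport hc
  have h2 : MemLp (extDeriv η) q (volume.restrict Ω) :=
    (continuous_extDeriv hη).memLp_of_hasCompactSupport (hasCompactSupport_extDeriv hc)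
  exact ⟨(h1.toLp η, h2.toLp _), h1.coeFn_toLp, h2.coeFn_toLp⟩

end WeakD

/-! ### Triangulations -/

section Geometry

variable {n : ℕ} {Ω : Set (Space n)} {T : Geometry.SimplicialComplex ℝ (Space n)}

/-- A Lipschitz domain lies on one side of its boundary, so it has no slits. This ensures that open
elements, known only to lie in the closure of Ω, lie in Ω itself. -/
theorem IsLipschitzDomain.interior_closure_subset (hΩ : IsLipschitzDomain Ω) :
    interior (closure Ω) ⊆ Ω := by
  intro x hx
  by_contra hxΩ
  have hfr : x ∈ frontier Ω := ⟨interior_subset hx, fun h => hxΩ (interior_subset h)⟩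
  obtain ⟨ν, hν, γ, C, hγ, hev⟩ := hΩ.boundary x hfr
  -- Near x, Ω is the set f < 0. Moving from x in the direction -ν makes f positive, so a whole
  -- neighbourhood of the new point avoids Ω although that point lies in the closure of Ω.
  set f : Space n → ℝ := fun y => γ ((ℝ ∙ ν)ᗮ.orthogonalProjectionOnto y) - inner ℝ ν y with hf
  have hfc : Continuous f := by
    have := hγ.continuous
    fun_prop
  have hfx : 0 ≤ f x := by
    have := hev.self_of_nhds
    simp only [hf]
    by_contra! hlt
    exact hxΩ (this.2 (by linarith))
  have hlim : Filter.Tendsto (fun s : ℝ => x - s • ν) (𝓝[>] 0) (𝓝 x) := by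
    have : Continuous fun s : ℝ => x - s • ν := by fun_prop
    have h0 := this.tendsto 0
    simp only [zero_smul, sub_zero] at h0
    exact h0.mono_left nhdsWithin_le_nhds
  obtain ⟨s, ⟨hs1, hs2⟩, hs0⟩ := ((hlim.eventually ((eventually_eventually_nhds.2 hev).and
    (isOpen_interior.mem_nhds hx))).and self_mem_nhdsWithin).exists
  have hfs : 0 < f (x - s • ν) := by
    have h1 : (ℝ ∙ ν)ᗮ.orthogonalProjectionOnto (x - s • ν) =
        (ℝ ∙ ν)ᗮ.orthogonalProjectionOnto x := by
      rw [map_sub, sub_eq_self]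
      rw [Submodule.orthogonalProjectionOnto_eq_zero_iff, Submodule.orthogonal_orthogonal]
      exact Submodule.smul_mem _ _ (Submodule.mem_span_singleton_self ν)
    have h2 : inner ℝ ν (x - s • ν) = inner ℝ ν x - s := by
      rw [inner_sub_right, inner_smul_right, real_inner_self_eq_norm_sq, hν]; ring
    simp only [hf, h1, h2] at hfx ⊢
    have : 0 < s := hs0
    linarith
  have hpos : ∀ᶠ z in 𝓝 (x - s • ν), 0 < f z := hfc.continuousAt.eventually (lt_mem_nhds hfs)
  have hcl := mem_closure_iff_frequently.1 (interior_subset hs2)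
  obtain ⟨z, hz, hz1, hz2⟩ := (hcl.and_eventually (hs1.and hpos)).exists
  have := hz1.1 hz
  simp only [hf] at hz2
  linarith

theorem volume_convexHull_eq_zero (s : Finset (Space n)) (hs : s.card ≤ n) :
    volume (convexHull ℝ (s : Set (Space n))) = 0 := by
  classical
  rcases s.eq_empty_or_nonempty with rfl | hne
  · simp
  refine measure_mono_null (convexHull_subset_affineSpan _)
    (Measure.addHaar_affineSubspace volume _ fun h => ?_)
  obtain ⟨c, hc⟩ : ∃ c, s.card = c + 1 := ⟨s.card - 1, by have := hne.card_pos; omega⟩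
  have h1 := finrank_vectorSpan_image_finset_le ℝ (id : Space n → Space n) s hc
  rw [Finset.image_id, ← direction_affineSpan, h, AffineSubspace.direction_top, finrank_top,
    finrank_euclideanSpace_fin] at h1
  omega

theorem convex_of_mem_elements {K : Set (Space n)} (hK : K ∈ elements T) : Convex ℝ K := by
  obtain ⟨s, -, -, rfl⟩ := hK
  exact convex_convexHull ℝ _

theorem restrict_interior_of_mem_elements {K : Set (Space n)} (hK : K ∈ elements T) :
    volume.restrict (interior K) = volume.restrict K :=
  Measure.restrict_congr_set
    (interior_ae_eq_of_null_frontier ((convex_of_mem_elements hK).addHaar_frontier volume))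

theorem finite_elements (hT : IsTriangulation T Ω) : (elements T).Finite := by
  refine (hT.finite.image fun s : Finset (Space n) => convexHull ℝ (s : Set (Space n))).subset ?_
  rintro K ⟨s, hs, -, rfl⟩
  exact ⟨s, hs, rfl⟩

theorem interior_subset_of_mem_elements (hΩ : IsLipschitzDomain Ω) (hT : IsTriangulation T Ω)
    {K : Set (Space n)} (hK : K ∈ elements T) : interior K ⊆ Ω := by
  refine (interior_mono ?_).trans hΩ.interior_closure_subset
  obtain ⟨s, hs, -, rfl⟩ := hK
  rw [← hT.space_eq]
  exact T.convexHull_subset_space hs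

/-- Two distinct n-simplices meet in the hull of at most n common vertices, a null set, and an open
null set is empty. -/
theorem disjoint_interior_of_mem_elements {K K' : Set (Space n)} (hK : K ∈ elements T)
    (hK' : K' ∈ elements T) (hne : K ≠ K') : Disjoint (interior K) (interior K') := by
  classical
  obtain ⟨s, hs, hsc, rfl⟩ := hK
  obtain ⟨t, ht, htc, rfl⟩ := hK'
  have hst : s ≠ t := by rintro rfl; exact hne rfl
  have hcard : (s ∩ t).card ≤ n := by
    have h1 : (s ∩ t).card < s.card := by
      refine Finset.card_lt_card ⟨Finset.inter_subset_left, fun h => hst ?_⟩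
      exact Finset.eq_of_subset_of_card_le (fun x hx => (Finset.mem_inter.1 (h hx)).2) (by omega)
    omega
  have h0 := volume_convexHull_eq_zero (s ∩ t) hcard
  rw [Finset.coe_inter] at h0
  rw [Set.disjoint_iff_inter_eq_empty]
  refine ((isOpen_interior.inter isOpen_interior).measure_eq_zero_iff volume).1 ?_
  exact measure_mono_null ((Set.inter_subset_inter interior_subset interior_subset).trans
    (T.inter_subset_convexHull hs ht)) h0

/-- What the open elements leave uncovered lies in frontiers of convex sets and in simplices of
lower dimension, all of them null. -/
theorem biUnion_interior_ae_eq (hΩ : IsLipschitzDomain Ω) (hT : IsTriangulation T Ω) :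
    (⋃ K ∈ elements T, interior K : Set (Space n)) =ᵐ[volume] Ω := by
  refine Filter.EventuallyLE.antisymm (LE.le.eventuallyLE
    (iUnion₂_subset fun K hK => interior_subset_of_mem_elements hΩ hT hK)) ?_
  have h1 : volume (⋃ K ∈ elements T, frontier K) = 0 :=
    (measure_biUnion_null_iff (finite_elements hT).countable).2 fun K hK =>
      (convex_of_mem_elements hK).addHaar_frontier volume
  have h2 : volume (⋃ s ∈ {s ∈ T.faces | s.card ≤ n}, convexHull ℝ (s : Set (Space n))) = 0 :=
    (measure_biUnion_null_iff (hT.finite.subset fun s hs => hs.1).countable).2 fun s hs =>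
      volume_convexHull_eq_zero s hs.2
  have h3 : Ω \ (⋃ K ∈ elements T, interior K) ⊆ (⋃ K ∈ elements T, frontier K) ∪
      ⋃ s ∈ {s ∈ T.faces | s.card ≤ n}, convexHull ℝ (s : Set (Space n)) := by
    rintro x ⟨hx, hx'⟩
    have hxs : x ∈ T.space := hT.space_eq ▸ subset_closure hx
    obtain ⟨s, hs, hxs⟩ := T.mem_space_iff.1 hxs
    by_cases hc : s.card ≤ n
    · exact Or.inr (mem_iUnion₂.2 ⟨s, ⟨hs, hc⟩, hxs⟩)
    · have hc' : s.card ≤ n + 1 := by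
        have := (T.indep hs).card_le_finrank_succ
        simp only [Fintype.card_coe] at this
        refine this.trans (Nat.succ_le_succ ?_)
        exact (Submodule.finrank_le _).trans (by simp)
      have hK : convexHull ℝ (s : Set (Space n)) ∈ elements T := ⟨s, hs, by omega, rfl⟩
      refine Or.inl (mem_iUnion₂.2 ⟨_, hK, subset_closure hxs, fun h => hx' ?_⟩)
      exact mem_iUnion₂.2 ⟨_, hK, h⟩
  exact ae_le_set.2 (measure_mono_null h3 (measure_union_null h1 h2))

/-- An integral over the domain is the sum of the integrals over the elements. -/
theorem finsum_setIntegral_elements (hΩ : IsLipschitzDomain Ω) (hT : IsTriangulation T Ω)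
    {f : Space n → ℝ} (hf : IntegrableOn f Ω) :
    ∑ᶠ K ∈ elements T, ∫ x in K, f x = ∫ x in Ω, f x := by
  have hfin := finite_elements hT
  rw [← setIntegral_congr_set (biUnion_interior_ae_eq hΩ hT),
    finsum_mem_eq_finite_toFinset_sum _ hfin]
  have hU : (⋃ K ∈ elements T, interior K) = ⋃ K ∈ hfin.toFinset, interior K := by
    simp
  rw [hU, integral_biUnion_finset _ (fun K _ => isOpen_interior.measurableSet)]
  · refine Finset.sum_congr rfl fun K hK => ?_
    rw [restrict_interior_of_mem_elements (hfin.mem_toFinset.1 hK)]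
  · intro K hK K' hK' hne
    exact disjoint_interior_of_mem_elements (hfin.mem_toFinset.1 hK) (hfin.mem_toFinset.1 hK') hne
  · intro K hK
    exact hf.mono_set (interior_subset_of_mem_elements hΩ hT (hfin.mem_toFinset.1 hK))

theorem restrict_le_of_mem_elements (hΩ : IsLipschitzDomain Ω) (hT : IsTriangulation T Ω)
    {K : Set (Space n)} (hK : K ∈ elements T) : volume.restrict K ≤ volume.restrict Ω := by
  rw [← restrict_interior_of_mem_elements hK]
  exact Measure.restrict_mono (interior_subset_of_mem_elements hΩ hT hK) le_rfl

end Geometry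

/-! ### Boundary pairings on a triangulated domain -/

section Decomposition

variable {g : Type*} [NormedAddCommGroup g] [InnerProductSpace ℝ g] {n : ℕ}
  {Ω : Set (Space n)} {T : Geometry.SimplicialComplex ℝ (Space n)} {k l : ℕ} {p q p' q' : ℝ≥0∞}

theorem integrableOn_bdryInt [ENNReal.HolderTriple p q' 1] [ENNReal.HolderTriple q p' 1]
    (h : k + 1 + l = n) (h' : k + (l + 1) = n) {u : Space n → Form n k g}
    {w : Space n → Form n (k + 1) g} {v : Space n → Form n l g} {z : Space n → Form n (l + 1) g}
    (hu : MemLp u p (volume.restrict Ω)) (hw : MemLp w q (volume.restrict Ω))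
    (hv : MemLp v p' (volume.restrict Ω)) (hz : MemLp z q' (volume.restrict Ω)) :
    IntegrableOn (fun x => pair h (w x) (v x) + (-1) ^ k * pair h' (u x) (z x)) Ω := by
  have h1 := memLp_one_iff_integrable.1 ((pairL g h).memLp_of_bilin 1 hw hv)
  have h2 := memLp_one_iff_integrable.1 ((pairL g h').memLp_of_bilin 1 hu hz)
  exact h1.add (h2.const_mul _)

/-- No continuity across faces is needed: both sides integrate the same function, formed with the
given w and z. For broken forms, the right side need not be a genuine boundary term. -/
theorem finsum_bdryInt [ENNReal.HolderTriple p q' 1] [ENNReal.HolderTriple q p' 1]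
    (hΩ : IsLipschitzDomain Ω) (hT : IsTriangulation T Ω) (h : k + 1 + l = n)
    {u : Space n → Form n k g}
    {w : Space n → Form n (k + 1) g} {v : Space n → Form n l g} {z : Space n → Form n (l + 1) g}
    (hu : MemLp u p (volume.restrict Ω)) (hw : MemLp w q (volume.restrict Ω))
    (hv : MemLp v p' (volume.restrict Ω)) (hz : MemLp z q' (volume.restrict Ω)) :
    ∑ᶠ K ∈ elements T, bdryInt h K u w v z = bdryInt h Ω u w v z :=
  finsum_setIntegral_elements hΩ hT (integrableOn_bdryInt h _ hu hw hv hz)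

theorem conf_subset_broken (hΩ : IsLipschitzDomain Ω) (hT : IsTriangulation T Ω) :
    Conf g Ω k p q ⊆ Broken g Ω T k p q := fun _ hu _ hK =>
  IsWeakD.mono hu (interior_subset_of_mem_elements hΩ hT hK)

/-- A pair on which the boundary pairing with all forms vanishes is conforming. -/
theorem mem_conf_of_bdryInt_eq_zero (h : k + 1 + l = n) {P : FormPair g Ω k p q}
    (hP : ∀ Q ∈ Conf g Ω l p' q', bdryInt h Ω P.1 P.2 Q.1 Q.2 = 0) : P ∈ Conf g Ω k p q := by
  intro l' h' η h1 h2 h3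
  obtain rfl : l' = l := by omega
  obtain ⟨Q, hQ1, hQ2⟩ := exists_formPair_of_contDiff Ω p' q' h1 h2
  rw [← bdryInt_congr h' (ae_eq_refl _) (ae_eq_refl _) hQ1 hQ2]
  exact hP Q ((isWeakD_extDeriv Ω h1).congr hQ1.symm hQ2.symm)

/-- A form that is orthogonal to all forms with zero trace has a weak exterior derivative. -/
theorem isWeakD_of_forall_zero_trace (h : k + 1 + l = n)
    {v : Space n → Form n l g} {z : Space n → Form n (l + 1) g}
    (hv : ∀ P ∈ Conf g Ω k p q, (∀ Q ∈ Conf g Ω l p' q', bdryInt h Ω P.1 P.2 Q.1 Q.2 = 0) →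
      bdryInt h Ω P.1 P.2 v z = 0) : IsWeakD Ω v z := by
  rw [isWeakD_iff h]
  intro η h1 h2 h3
  obtain ⟨P, hP1, hP2⟩ := exists_formPair_of_contDiff Ω p q h1 h2
  rw [← bdryInt_congr h hP1 hP2 (ae_eq_refl _) (ae_eq_refl _)]
  refine hv P ((isWeakD_extDeriv Ω h1).congr hP1.symm hP2.symm) fun Q hQ => ?_
  rw [bdryInt_congr h hP1 hP2 (ae_eq_refl _) (ae_eq_refl _)]
  -- A test form with compact support in Ω has zero trace: this is exactly the definition of the
  -- weak derivative of Q.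
  exact (isWeakD_iff h).1 hQ η h1 h2 h3

/-- A form with the boundary pairings on an element of a form with weak exterior derivative has
itself a weak exterior derivative. -/
theorem isWeakD_of_forall_bdryInt_eq (hΩ : IsLipschitzDomain Ω) (hT : IsTriangulation T Ω)
    (h : k + 1 + l = n) {K : Set (Space n)} (hK : K ∈ elements T)
    {v v' : Space n → Form n l g} {z z' : Space n → Form n (l + 1) g}
    (hw : IsWeakD (interior K) v z)
    (heq : ∀ P ∈ Broken g Ω T k p q, bdryInt h K P.1 P.2 v z = bdryInt h K P.1 P.2 v' z') :
    IsWeakD (interior K) v' z' := by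
  rw [isWeakD_iff h]
  intro η h1 h2 h3
  obtain ⟨P, hP1, hP2⟩ := exists_formPair_of_contDiff Ω p q h1 h2
  have hle := ae_mono (restrict_le_of_mem_elements hΩ hT hK)
  have hP : P ∈ Broken g Ω T k p q :=
    conf_subset_broken hΩ hT ((isWeakD_extDeriv Ω h1).congr hP1.symm hP2.symm)
  have e := heq P hP
  rw [bdryInt_congr h (hle hP1) (hle hP2) (ae_eq_refl v) (ae_eq_refl z),
    bdryInt_congr h (hle hP1) (hle hP2) (ae_eq_refl v') (ae_eq_refl z')] at e
  have e' := (isWeakD_iff h).1 hw η h1 h2 h3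
  -- The frontier of K is null, so integrals over K and over its interior agree.
  simp only [bdryInt, restrict_interior_of_mem_elements hK] at e e' ⊢
  rw [← e, e']

theorem isFiniteMeasure_restrict_of_isBounded (hb : Bornology.IsBounded Ω) :
    IsFiniteMeasure (volume.restrict Ω) :=
  ⟨by rw [Measure.restrict_apply_univ]; exact hb.measure_lt_top⟩

theorem isBounded_of_mem_elements {K : Set (Space n)} (hK : K ∈ elements T) :
    Bornology.IsBounded K := by
  obtain ⟨s, -, -, rfl⟩ := hK
  exact isBounded_convexHull.2 s.finite_toSet.isBounded

/-- Two forms with weak exterior derivatives have the same trace on the boundary of an element if and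
only if their boundary pairings agree. -/
theorem sameTrace_iff (h : k + 1 + l = n) {K : Set (Space n)} (hK : K ∈ elements T)
    {S : Set (FormPair g Ω k p q)} (hp' : 1 ≤ p') (hq' : 1 ≤ q')
    {v v' : Space n → Form n l g} {z z' : Space n → Form n (l + 1) g}
    (hv : MemLp v p' (volume.restrict K)) (hz : MemLp z q' (volume.restrict K))
    (hv' : MemLp v' p' (volume.restrict K)) (hz' : MemLp z' q' (volume.restrict K))
    (hw : IsWeakD (interior K) v z) (hw' : IsWeakD (interior K) v' z') :
    SameTrace h S K p' q' v v' ↔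
      ∀ P ∈ S, bdryInt h K P.1 P.2 v z = bdryInt h K P.1 P.2 v' z' := by
  have := isFiniteMeasure_restrict_of_isBounded (isBounded_of_mem_elements hK)
  -- A trace is defined with some weak derivative of the form; uniqueness lets it be replaced by the
  -- given one.
  have uniq : ∀ {v : Space n → Form n l g} {z y : Space n → Form n (l + 1) g},
      MemLp v p' (volume.restrict K) → MemLp z q' (volume.restrict K) →
      MemLp y q' (volume.restrict K) → IsWeakD (interior K) v z → IsWeakD (interior K) v y →
      z =ᵐ[volume.restrict K] y := by
    intro v z y h1 h2 h3 h4 h5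
    rw [← restrict_interior_of_mem_elements hK] at *
    exact h4.ae_eq (by omega : l + 1 + k = n) isOpen_interior h5 (h1.integrable hp')
      (h2.integrable hq') (h3.integrable hq')
  constructor
  · rintro ⟨τ, ⟨-, y, hy, hyw, hτ⟩, -, y', hy', hyw', hτ'⟩ P hP
    rw [bdryInt_congr h (ae_eq_refl _) (ae_eq_refl _) (ae_eq_refl _) (uniq hv hz hy hw hyw),
      bdryInt_congr h (ae_eq_refl _) (ae_eq_refl _) (ae_eq_refl _) (uniq hv' hz' hy' hw' hyw'),
      ← hτ ⟨P, hP⟩, ← hτ' ⟨P, hP⟩]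
  · intro heq
    exact ⟨fun P => bdryInt h K P.1.1 P.1.2 v z, ⟨hv, z, hz, hw, fun _ => rfl⟩,
      hv', z', hz', hw', fun P => heq P.1 P.2⟩

end Decomposition

/-! ### Integrability of the fields -/

section Fields

/-- The Hölder exponents of the problem: 1/4 + 3/4 = 1 for the boundary pairings, and below 1/4 +
1/2 = 3/4 for [A ∧ H] and 1/4 + 1/4 = 1/2 for [A ∧ A] and [A ∧ D]. -/
instance holderTriple_four_fourThirds_one : ENNReal.HolderTriple 4 (4 / 3) 1 := ⟨by
  have h1 : (4 / 3 : ℝ≥0∞)⁻¹ = 3 / 4 := by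
    rw [ENNReal.inv_div (by simp) (by simp)]
  rw [h1, inv_one, ← one_div, ENNReal.div_add_div_same]
  norm_num
  exact ENNReal.div_self (by simp) (by simp)⟩

instance holderTriple_four_two_fourThirds : ENNReal.HolderTriple 4 2 (4 / 3) := ⟨by
  have h1 : (4 / 3 : ℝ≥0∞)⁻¹ = 3 / 4 := by
    rw [ENNReal.inv_div (by simp) (by simp)]
  have h2 : (2 : ℝ≥0∞)⁻¹ = 2 / 4 := by
    rw [← one_div, ENNReal.div_eq_div_iff (by simp) (by simp) (by simp) (by simp)]; norm_num
  rw [h1, h2, ← one_div, ENNReal.div_add_div_same]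
  norm_num⟩

instance holderTriple_four_four_two : ENNReal.HolderTriple 4 4 2 := ⟨by
  have h2 : (2 : ℝ≥0∞)⁻¹ = 2 / 4 := by
    rw [← one_div, ENNReal.div_eq_div_iff (by simp) (by simp) (by simp) (by simp)]; norm_num
  rw [h2, ← one_div, ENNReal.div_add_div_same]
  norm_num⟩

theorem memLp_clm_apply {α E F : Type*} [MeasurableSpace α] {μ : Measure α}
    [NormedAddCommGroup E] [NormedSpace ℝ E] [NormedAddCommGroup F] [NormedSpace ℝ F]
    {p : ℝ≥0∞} {κ : α → E →L[ℝ] F} {u : α → E} (hκ : MemLp κ ⊤ μ) (hu : MemLp u p μ) :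
    MemLp (fun x => κ x (u x)) p μ :=
  (ContinuousLinearMap.id ℝ (E →L[ℝ] F)).memLp_of_bilin p hκ hu

theorem memLp_univ_sum {α E ι : Type*} [MeasurableSpace α] {μ : Measure α} [Fintype ι]
    [NormedAddCommGroup E] {p : ℝ≥0∞} {f : ι → α → E} (hf : ∀ i, MemLp (f i) p μ) :
    MemLp (fun x => ∑ i, f i x) p μ :=
  memLp_finsetSum Finset.univ fun i _ => hf i

theorem memLp_sum_toSpanSingleton {g ι : Type*} [Fintype ι] [NormedAddCommGroup g]
    [InnerProductSpace ℝ g] {n k l : ℕ} {μ : Measure (Space n)} {p : ℝ≥0∞}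
    {κ : Space n → Form n k ℝ →L[ℝ] Form n l ℝ} {u : Space n → Form n k g}
    (hκ : MemLp κ ⊤ μ) (hu : MemLp u p μ) (b : ι → g) :
    MemLp (fun x => ∑ i, (ContinuousLinearMap.toSpanSingleton ℝ
      (b i)).compContinuousAlternatingMap
        (κ x ((innerSL ℝ (b i)).compContinuousAlternatingMap (u x)))) p μ := by
  refine memLp_univ_sum fun i => ?_
  have h1 : MemLp (fun x => (innerSL ℝ (b i)).compContinuousAlternatingMap (u x)) p μ :=
    (ContinuousLinearMap.compContinuousAlternatingMapCLM ℝ (Space n) g ℝ (ι := Fin k)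
      (innerSL ℝ (b i))).comp_memLp' hu
  have h2 : MemLp (fun x => κ x ((innerSL ℝ (b i)).compContinuousAlternatingMap (u x))) p μ :=
    memLp_clm_apply hκ h1
  exact (ContinuousLinearMap.compContinuousAlternatingMapCLM ℝ (Space n) ℝ g (ι := Fin l)
    (ContinuousLinearMap.toSpanSingleton ℝ (b i))).comp_memLp' h2

theorem memLp_extendCoeff {g : Type*} [NormedAddCommGroup g] [InnerProductSpace ℝ g]
    [FiniteDimensional ℝ g] {n k l : ℕ} {μ : Measure (Space n)} {p : ℝ≥0∞}
    {κ : Space n → Form n k ℝ →L[ℝ] Form n l ℝ} {u : Space n → Form n k g}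
    (hκ : MemLp κ ⊤ μ) (hu : MemLp u p μ) : MemLp (fun x => extendCoeff (κ x) (u x)) p μ :=
  memLp_sum_toSpanSingleton hκ hu (stdOrthonormalBasis ℝ g)

variable {g : Type*} [NormedLieRing g] [InvariantLieAlgebra g] [FiniteDimensional ℝ g]

theorem memLp_brk {n k l j : ℕ} (h : k + l = j) {p q r : ℝ≥0∞} [ENNReal.HolderTriple p q r]
    {μ : Measure (Space n)} {u : Space n → Form n k g} {v : Space n → Form n l g}
    (hu : MemLp u p μ) (hv : MemLp v q μ) : MemLp (fun x => brk h (u x) (v x)) r μ :=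
  (wedgeL n (bracketL g) h).memLp_of_bilin r hu hv

variable {m : ℕ} {Ω : Set (Space (m + 2))}

theorem memLp_magneticField {μinv : Space (m + 2) → Form (m + 2) 2 ℝ →L[ℝ] Form (m + 2) m ℝ}
    (hμ : MemLp μinv ⊤ (volume.restrict Ω)) (A : ℝ → FormPair g Ω 1 4 2) (t : ℝ) :
    MemLp (magneticField μinv A t) 2 (volume.restrict Ω) := by
  have h1 : MemLp (fun x => brk (by omega : 1 + 1 = 2) ((A t).1 x) ((A t).1 x)) 2
    (volume.restrict Ω) := memLp_brk (p := 4) (q := 4) _ (Lp.memLp _) (Lp.memLp _)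
  exact memLp_extendCoeff hμ ((Lp.memLp (A t).2).add (h1.const_smul (1 / 2 : ℝ)))

/-- The exterior derivative of `H` according to the Yang–Mills equations,
`Ḋ - [φ, D] - [A ∧ H]`. -/
def derivH (I : Set ℝ) (μinv : Space (m + 2) → Form (m + 2) 2 ℝ →L[ℝ] Form (m + 2) m ℝ)
    (A : ℝ → FormPair g Ω 1 4 2) (φ : ℝ → FormPair g Ω 0 ⊤ 4) (D : ℝ → LpForm g Ω (m + 1) 4)
    (t : ℝ) (x : Space (m + 2)) : Form (m + 2) (m + 1) g :=
  derivWithin D I t x - brk (by omega) ((φ t).1 x) (D t x) -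
    brk (by omega) ((A t).1 x) (magneticField μinv A t x)

/-- The exterior derivative of `D` according to the Yang–Mills equations, `ρ - [A ∧ D]`. -/
def derivD (A : ℝ → FormPair g Ω 1 4 2) (D : ℝ → LpForm g Ω (m + 1) 4)
    (ρ : ℝ → LpForm g Ω (m + 2) 1) (t : ℝ) (x : Space (m + 2)) : Form (m + 2) (m + 1 + 1) g :=
  ρ t x - brk (by omega) ((A t).1 x) (D t x)

theorem fourThirds_le_four : (4 / 3 : ℝ≥0∞) ≤ 4 :=
  ENNReal.div_le_of_le_mul (le_mul_of_one_le_right' (by norm_num))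

theorem one_le_fourThirds : (1 : ℝ≥0∞) ≤ 4 / 3 := by
  rw [ENNReal.le_div_iff_mul_le (by simp) (by simp)]
  norm_num

theorem memLp_derivH (hb : Bornology.IsBounded Ω) (I : Set ℝ)
    {μinv : Space (m + 2) → Form (m + 2) 2 ℝ →L[ℝ] Form (m + 2) m ℝ}
    (hμ : MemLp μinv ⊤ (volume.restrict Ω))
    (A : ℝ → FormPair g Ω 1 4 2) (φ : ℝ → FormPair g Ω 0 ⊤ 4) (D : ℝ → LpForm g Ω (m + 1) 4)
    (t : ℝ) : MemLp (derivH I μinv A φ D t) (4 / 3) (volume.restrict Ω) := by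
  have := isFiniteMeasure_restrict_of_isBounded hb
  have h1 : MemLp (fun x => brk (by omega : 0 + (m + 1) = m + 1) ((φ t).1 x) (D t x)) 4
    (volume.restrict Ω) := memLp_brk (p := ⊤) (q := 4) _ (Lp.memLp _) (Lp.memLp _)
  have h2 : MemLp (fun x => brk (by omega : 1 + m = m + 1) ((A t).1 x)
      (magneticField μinv A t x)) (4 / 3) (volume.restrict Ω) :=
    memLp_brk (p := 4) (q := 2) _ (Lp.memLp _) (memLp_magneticField hμ A t)
  exact (((Lp.memLp (derivWithin D I t)).sub h1).mono_exponent fourThirds_le_four).sub h2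

theorem memLp_derivD (hb : Bornology.IsBounded Ω)
    (A : ℝ → FormPair g Ω 1 4 2) (D : ℝ → LpForm g Ω (m + 1) 4)
    (ρ : ℝ → LpForm g Ω (m + 2) 1) (t : ℝ) :
    MemLp (derivD A D ρ t) 1 (volume.restrict Ω) := by
  have := isFiniteMeasure_restrict_of_isBounded hb
  have h1 : MemLp (fun x => brk (by omega : 1 + (m + 1) = m + 2) ((A t).1 x) (D t x)) 2
    (volume.restrict Ω) := memLp_brk (p := 4) (q := 4) _ (Lp.memLp _) (Lp.memLp _)
  exact (Lp.memLp (ρ t)).sub (h1.mono_exponent (by norm_num))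

/-- The first weak equation as a boundary pairing. -/
theorem formA_eq_neg_bdryInt (U : Set (Space (m + 2))) (I : Set ℝ)
    (μinv : Space (m + 2) → Form (m + 2) 2 ℝ →L[ℝ] Form (m + 2) m ℝ)
    (A : ℝ → FormPair g Ω 1 4 2) (φ : ℝ → FormPair g Ω 0 ⊤ 4) (D : ℝ → LpForm g Ω (m + 1) 4)
    (t : ℝ) (A' : FormPair g Ω 1 4 2) :
    formA U I μinv A φ D t A' = -bdryInt (by omega) U A'.1 A'.2 (magneticField μinv A t)
      (derivH I μinv A φ D t) := by
  rw [formA, bdryInt, ← integral_neg]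
  congr 1
  ext x
  -- For 1-forms the two signs cancel and [A ∧ A'] = [A' ∧ A]; invariance then moves the bracket
  -- onto H.
  rw [derivH, covD, brk_comm _ (by omega : 1 + 1 = 1 + 1) ((A t).1 x) (A'.1 x)]
  simp only [← pairL_apply, map_add, map_sub, map_neg, map_smul, _root_.add_apply,
    _root_.neg_apply, _root_.smul_apply]
  simp only [pairL_apply]
  rw [pair_brk (by omega) _ (by omega : 1 + m = m + 1) (by omega)]
  simp
  ring

/-- The second weak equation as a boundary pairing. -/
theorem formφ_eq_bdryInt (U : Set (Space (m + 2)))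
    (A : ℝ → FormPair g Ω 1 4 2) (D : ℝ → LpForm g Ω (m + 1) 4) (ρ : ℝ → LpForm g Ω (m + 2) 1)
    (t : ℝ) (φ' : FormPair g Ω 0 ⊤ 4) :
    formφ U A D ρ t φ' = bdryInt (by omega) U φ'.1 φ'.2 (D t) (derivD A D ρ t) := by
  rw [formφ, bdryInt]
  congr 1
  ext x
  -- Here φ' has degree 0, so [A ∧ φ'] = -[φ' ∧ A]; this is the minus sign in `derivD`.
  rw [derivD, covD, brk_comm _ (by omega : 0 + 1 = 0 + 1) ((A t).1 x) (φ'.1 x)]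
  simp only [← pairL_apply, map_add, map_sub, map_neg, map_smul, _root_.add_apply,
    _root_.neg_apply, _root_.smul_apply]
  simp only [pairL_apply]
  rw [pair_brk (by omega) _ (by omega : 1 + (m + 1) = m + 2) (by omega)]
  simp
  ring

end Fields

/-! ### Traces, jumps and conforming multipliers. -/

section Multipliers

variable {g : Type*} [NormedAddCommGroup g] [InnerProductSpace ℝ g] {n : ℕ}
  {Ω : Set (Space n)} {T : Geometry.SimplicialComplex ℝ (Space n)} {k l : ℕ} {p q p' q' : ℝ≥0∞}

/-- If the boundary pairings of `v` agree on all elements with those of a conforming multiplier, then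
the traces agree and `v` is orthogonal to the forms with zero trace. -/
theorem sameTrace_and_bdryInt_eq_zero [ENNReal.HolderTriple p q' 1] [ENNReal.HolderTriple q p' 1]
    (hΩ : IsLipschitzDomain Ω) (hT : IsTriangulation T Ω) (h : k + 1 + l = n)
    (hp' : 1 ≤ p') (hq' : 1 ≤ q') {Q : FormPair g Ω l p' q'} (hQ : Q ∈ Conf g Ω l p' q')
    {v : Space n → Form n l g} {z : Space n → Form n (l + 1) g}
    (hv : MemLp v p' (volume.restrict Ω)) (hz : MemLp z q' (volume.restrict Ω))
    (heq : ∀ K ∈ elements T, ∀ P ∈ Broken g Ω T k p q,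
      bdryInt h K P.1 P.2 Q.1 Q.2 = bdryInt h K P.1 P.2 v z) :
    (∀ K ∈ elements T, SameTrace h (Broken g Ω T k p q) K p' q' Q.1 v) ∧
      ∀ P ∈ Conf g Ω k p q, bdryInt h Ω P.1 P.2 Q.1 Q.2 = 0 → bdryInt h Ω P.1 P.2 v z = 0 := by
  refine ⟨fun K hK => ?_, fun P hP hPQ => ?_⟩
  · have hle := restrict_le_of_mem_elements hΩ hT hK
    have hQK : IsWeakD (interior K) Q.1 Q.2 := conf_subset_broken hΩ hT hQ K hK
    exact (sameTrace_iff h hK hp' hq' ((Lp.memLp Q.1).mono_measure hle)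
      ((Lp.memLp Q.2).mono_measure hle) (hv.mono_measure hle) (hz.mono_measure hle) hQK
      (isWeakD_of_forall_bdryInt_eq hΩ hT h hK hQK (heq K hK))).2 (heq K hK)
  · rw [← finsum_bdryInt hΩ hT h (Lp.memLp P.1) (Lp.memLp P.2) hv hz, ← hPQ,
      ← finsum_bdryInt hΩ hT h (Lp.memLp P.1) (Lp.memLp P.2) (Lp.memLp Q.1) (Lp.memLp Q.2)]
    exact finsum_mem_congr rfl fun K hK => (heq K hK P (conf_subset_broken hΩ hT hP)).symm

/-- If `v` has a weak exterior derivative, then its boundary pairings agree with those of every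
conforming multiplier with the same traces. -/
theorem bdryInt_eq_of_sameTrace
    (hΩ : IsLipschitzDomain Ω) (hT : IsTriangulation T Ω) (h : k + 1 + l = n)
    (hp' : 1 ≤ p') (hq' : 1 ≤ q') {Q : FormPair g Ω l p' q'} (hQ : Q ∈ Conf g Ω l p' q')
    {v : Space n → Form n l g} {z : Space n → Form n (l + 1) g}
    (hv : MemLp v p' (volume.restrict Ω)) (hz : MemLp z q' (volume.restrict Ω))
    (hw : IsWeakD Ω v z) {K : Set (Space n)} (hK : K ∈ elements T) {S : Set (FormPair g Ω k p q)}
    (htr : SameTrace h S K p' q' Q.1 v) {P : FormPair g Ω k p q} (hP : P ∈ S) :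
    bdryInt h K P.1 P.2 Q.1 Q.2 = bdryInt h K P.1 P.2 v z := by
  have hle := restrict_le_of_mem_elements hΩ hT hK
  exact (sameTrace_iff h hK hp' hq' ((Lp.memLp Q.1).mono_measure hle)
    ((Lp.memLp Q.2).mono_measure hle) (hv.mono_measure hle) (hz.mono_measure hle)
    (conf_subset_broken hΩ hT hQ K hK)
    (hw.mono (interior_subset_of_mem_elements hΩ hT hK))).1 htr P hP

/-- A broken form is conforming with zero trace on the boundary of the domain if and only if its jumps
are orthogonal to all multipliers. -/
theorem mem_conf_zero_trace_iff [ENNReal.HolderTriple p q' 1] [ENNReal.HolderTriple q p' 1]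
    (hΩ : IsLipschitzDomain Ω) (hT : IsTriangulation T Ω) (h : k + 1 + l = n)
    (P : FormPair g Ω k p q) :
    (P ∈ Conf g Ω k p q ∧ ∀ Q ∈ Conf g Ω l p' q', bdryInt h Ω P.1 P.2 Q.1 Q.2 = 0) ↔
      ∀ Q ∈ Conf g Ω l p' q', ∑ᶠ K ∈ elements T, bdryInt h K P.1 P.2 Q.1 Q.2 = 0 := by
  have hsum : ∀ Q : FormPair g Ω l p' q', ∑ᶠ K ∈ elements T, bdryInt h K P.1 P.2 Q.1 Q.2 =
      bdryInt h Ω P.1 P.2 Q.1 Q.2 := fun Q =>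
    finsum_bdryInt hΩ hT h (Lp.memLp P.1) (Lp.memLp P.2) (Lp.memLp Q.1) (Lp.memLp Q.2)
  simp only [hsum]
  exact ⟨fun hP => hP.2, fun hP => ⟨mem_conf_of_bdryInt_eq_zero h hP, hP⟩⟩

end Multipliers

/-! ### Regularity of the fields of a weak solution. -/

section Solutions

variable {g : Type*} [NormedLieRing g] [InvariantLieAlgebra g] [FiniteDimensional ℝ g]
  {m : ℕ} {Ω : Set (Space (m + 2))} {I : Set ℝ}
  {μinv : Space (m + 2) → Form (m + 2) 2 ℝ →L[ℝ] Form (m + 2) m ℝ}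
  {A : ℝ → FormPair g Ω 1 4 2} {φ : ℝ → FormPair g Ω 0 ⊤ 4} {D : ℝ → LpForm g Ω (m + 1) 4}
  {ρ : ℝ → LpForm g Ω (m + 2) 1}

/-- Smooth compactly supported forms are admissible in the weak equation, which is then the
definition of the weak derivative. -/
theorem SolvesYM.isWeakD_H (hs : SolvesYM I μinv A φ D ρ) {t : ℝ} (ht : t ∈ I) :
    IsWeakD Ω (magneticField μinv A t) (derivH I μinv A φ D t) := by
  refine isWeakD_of_forall_zero_trace (k := 1) (p := 4) (q := 2) (p' := 2) (q' := 4 / 3)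
    (by omega) fun P hP hP' => ?_
  have := hs.eq_A t ht P ⟨hP, hP'⟩
  rwa [formA_eq_neg_bdryInt, neg_eq_zero] at this

theorem SolvesYM.isWeakD_D (hs : SolvesYM I μinv A φ D ρ) {t : ℝ} (ht : t ∈ I) :
    IsWeakD Ω (D t) (derivD A D ρ t) := by
  refine isWeakD_of_forall_zero_trace (k := 0) (p := ⊤) (q := 4) (p' := 4 / 3) (q' := 1)
    (by omega) fun P hP hP' => ?_
  have := hs.eq_φ t ht P ⟨hP, hP'⟩
  rwa [formφ_eq_bdryInt] at this

/-- A solution of the weak Yang–Mills equations solves the domain-decomposed equations with all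
multipliers that have the boundary pairings of `H` and `D`. -/
theorem SolvesYM.solvesDD (hs : SolvesYM I μinv A φ D ρ) (hΩ : IsLipschitzDomain Ω)
    {T : Geometry.SimplicialComplex ℝ (Space (m + 2))} (hT : IsTriangulation T Ω)
    {Hhat : ℝ → FormPair g Ω m 2 (4 / 3)} {Dhat : ℝ → FormPair g Ω (m + 1) (4 / 3) 1}
    (hH : ∀ t ∈ I, Hhat t ∈ VhatH g Ω) (hD : ∀ t ∈ I, Dhat t ∈ VhatD g Ω)
    (eH : ∀ t ∈ I, ∀ K ∈ elements T, ∀ P ∈ DV1 g Ω T,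
      bdryInt (by omega) K P.1 P.2 (Hhat t).1 (Hhat t).2 =
        bdryInt (by omega) K P.1 P.2 (magneticField μinv A t) (derivH I μinv A φ D t))
    (eD : ∀ t ∈ I, ∀ K ∈ elements T, ∀ P ∈ DV0 g Ω T,
      bdryInt (by omega) K P.1 P.2 (Dhat t).1 (Dhat t).2 =
        bdryInt (by omega) K P.1 P.2 (D t) (derivD A D ρ t)) :
    SolvesDD T I μinv A φ D ρ Hhat Dhat where
  contDiffOn_A := hs.contDiffOn_A
  mem_A t ht := conf_subset_broken hΩ hT (hs.mem_A t ht).1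
  continuousOn_φ := hs.continuousOn_φ
  mem_φ t ht := conf_subset_broken hΩ hT (hs.mem_φ t ht).1
  mem_Hhat := hH
  mem_Dhat := hD
  eq_A t ht K hK A' hA' := by
    rw [formA_eq_neg_bdryInt, eH t ht K hK A' hA', neg_add_cancel]
  eq_φ t ht K hK φ' hφ' := by
    rw [formφ_eq_bdryInt, eD t ht K hK φ' hφ', sub_self]
  continuity_A t ht :=
    (mem_conf_zero_trace_iff (p' := 2) (q' := 4 / 3) hΩ hT _ (A t)).1 (hs.mem_A t ht)
  continuity_φ t ht :=
    (mem_conf_zero_trace_iff (p' := 4 / 3) (q' := 1) hΩ hT _ (φ t)).1 (hs.mem_φ t ht)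

end Solutions

end YM

end

/-! ### Equivalence of the two formulations. -/

theorem mainTheorem3 {g : Type*} [YM.NormedLieRing g] [YM.InvariantLieAlgebra g]
    [FiniteDimensional ℝ g] {m : ℕ} {Ω : Set (YM.Space (m + 2))}
    (hΩ : YM.IsLipschitzDomain Ω) (hbdd : Bornology.IsBounded Ω)
    (T : Geometry.SimplicialComplex ℝ (YM.Space (m + 2))) (hT : YM.IsTriangulation T Ω)
    (ε : YM.Space (m + 2) → YM.Form (m + 2) 1 ℝ →L[ℝ] YM.Form (m + 2) (m + 1) ℝ)
    (hε : YM.IsMaterialTensor (by omega) Ω ε)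
    (μinv : YM.Space (m + 2) → YM.Form (m + 2) 2 ℝ →L[ℝ] YM.Form (m + 2) m ℝ)
    (hμ : YM.IsMaterialTensor (by omega) Ω μinv)
    (I : Set ℝ) (hI : I.OrdConnected) (hI' : I.Nontrivial)
    (A : ℝ → YM.FormPair g Ω 1 4 2) (hA : ContDiffOn ℝ 1 A I)
    (hADV : ∀ t ∈ I, A t ∈ YM.DV1 g Ω T)
    (φ : ℝ → YM.FormPair g Ω 0 ⊤ 4) (hφ : ContinuousOn φ I)
    (hφDV : ∀ t ∈ I, φ t ∈ YM.DV0 g Ω T)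
    (D : ℝ → YM.LpForm g Ω (m + 1) 4) (hD : ContDiffOn ℝ 1 D I)
    (hDE : ∀ t ∈ I, ∀ᵐ x ∂volume.restrict Ω,
      D t x = YM.extendCoeff (ε x) (YM.electricField I A φ t x))
    (ρ : ℝ → YM.LpForm g Ω (m + 2) 1) (hρ : ContDiffOn ℝ 1 ρ I) :
    (∀ (Hhat : ℝ → YM.FormPair g Ω m 2 (4 / 3)) (Dhat : ℝ → YM.FormPair g Ω (m + 1) (4 / 3) 1),
      (∀ t ∈ I, Hhat t ∈ YM.VhatH g Ω) → (∀ t ∈ I, Dhat t ∈ YM.VhatD g Ω) →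
      (YM.SolvesDD T I μinv A φ D ρ Hhat Dhat ↔
        YM.SolvesYM I μinv A φ D ρ ∧
        ∀ t ∈ I, ∀ K ∈ YM.elements T,
          YM.SameTrace (by omega) (YM.DV1 g Ω T) K 2 (4 / 3)
            ((Hhat t).1) (YM.magneticField μinv A t) ∧
          YM.SameTrace (by omega) (YM.DV0 g Ω T) K (4 / 3) 1
            ((Dhat t).1) (D t))) ∧
    (YM.SolvesYM I μinv A φ D ρ →
      ∃ (Hhat : ℝ → YM.FormPair g Ω m 2 (4 / 3)) (Dhat : ℝ → YM.FormPair g Ω (m + 1) (4 / 3) 1),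
        YM.SolvesDD T I μinv A φ D ρ Hhat Dhat) := by
  have hfin := YM.isFiniteMeasure_restrict_of_isBounded hbdd
  have mH := fun t => YM.memLp_magneticField hμ.memLp A t
  have mdH := fun t => YM.memLp_derivH hbdd I hμ.memLp A φ D t
  have mD : ∀ t, MemLp (D t) (4 / 3) (volume.restrict Ω) := fun t =>
    (Lp.memLp (D t)).mono_exponent YM.fourThirds_le_four
  have mdD := fun t => YM.memLp_derivD hbdd A D ρ t
  have h1 : (1 : ℝ≥0∞) ≤ 4 / 3 := YM.one_le_fourThirds
  refine ⟨fun Hhat Dhat hH hDh => ⟨fun hs => ?_, fun ⟨hs, htr⟩ => ?_⟩, fun hs => ?_⟩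
  -- On each element the first equation reads: the pairing with Ĥ minus the pairing with (H,
  -- `derivH`) is zero.
  · have keyH := fun t (ht : t ∈ I) => YM.sameTrace_and_bdryInt_eq_zero (k := 1) (p := 4) (q := 2)
      hΩ hT (by omega) (by norm_num) h1 (hH t ht) (mH t) (mdH t) fun K hK P hP => by
        have := hs.eq_A t ht K hK P hP
        rw [YM.formA_eq_neg_bdryInt] at this
        linarith
    have keyD := fun t (ht : t ∈ I) => YM.sameTrace_and_bdryInt_eq_zero (k := 0) (p := ⊤) (q := 4)
      hΩ hT (by omega) h1 le_rfl (hDh t ht) (mD t) (mdD t) fun K hK P hP => by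
        have := hs.eq_φ t ht K hK P hP
        rw [YM.formφ_eq_bdryInt] at this
        linarith
    refine ⟨⟨hs.contDiffOn_A, fun t ht => ?_, hs.continuousOn_φ, fun t ht => ?_,
      fun t ht A' hA' => ?_, fun t ht φ' hφ' => ?_⟩,
      fun t ht K hK => ⟨(keyH t ht).1 K hK, (keyD t ht).1 K hK⟩⟩
    · exact (YM.mem_conf_zero_trace_iff (p' := 2) (q' := 4 / 3) hΩ hT _ (A t)).2
        (hs.continuity_A t ht)
    · exact (YM.mem_conf_zero_trace_iff (p' := 4 / 3) (q' := 1) hΩ hT _ (φ t)).2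
        (hs.continuity_φ t ht)
    · rw [YM.formA_eq_neg_bdryInt, neg_eq_zero]
      exact (keyH t ht).2 A' hA'.1 (hA'.2 _ (hH t ht))
    · rw [YM.formφ_eq_bdryInt]
      exact (keyD t ht).2 φ' hφ'.1 (hφ'.2 _ (hDh t ht))
  · exact hs.solvesDD hΩ hT hH hDh
      (fun t ht K hK P hP => YM.bdryInt_eq_of_sameTrace hΩ hT _ (by norm_num) h1 (hH t ht) (mH t)
        (mdH t) (hs.isWeakD_H ht) hK (htr t ht K hK).1 hP)
      (fun t ht K hK P hP => YM.bdryInt_eq_of_sameTrace hΩ hT _ h1 le_rfl (hDh t ht) (mD t)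
        (mdD t) (hs.isWeakD_D ht) hK (htr t ht K hK).2 hP)
  -- The multipliers are H and D themselves, with the derivatives dictated by the equations.
  · refine ⟨fun t => ((mH t).toLp _, (mdH t).toLp _), fun t => ((mD t).toLp _, (mdD t).toLp _),
      hs.solvesDD hΩ hT (fun t ht => ?_) (fun t ht => ?_) (fun t ht K hK P hP => ?_)
        (fun t ht K hK P hP => ?_)⟩
    · exact (hs.isWeakD_H ht).congr (mH t).coeFn_toLp.symm (mdH t).coeFn_toLp.symm
    · exact (hs.isWeakD_D ht).congr (mD t).coeFn_toLp.symm (mdD t).coeFn_toLp.symm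
    · have hle := ae_mono (YM.restrict_le_of_mem_elements hΩ hT hK)
      exact YM.bdryInt_congr _ (ae_eq_refl _) (ae_eq_refl _) (hle (mH t).coeFn_toLp)
        (hle (mdH t).coeFn_toLp)
    · have hle := ae_mono (YM.restrict_le_of_mem_elements hΩ hT hK)
      exact YM.bdryInt_congr _ (ae_eq_refl _) (ae_eq_refl _) (hle (mD t).coeFn_toLp)
        (hle (mdD t).coeFn_toLp)
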